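/- Let $F$ be a field. A generalized layered graph $\Gamma$ is a directed graph with vertex set $V$, edge set $E$ (multiple edges allowed; each edge $e$ goes from its tail $t(e)$ to its head $h(e)$), together with a rank (level) function $|\cdot|:V\to\mathbb Z_{\ge 0}$ with $|t(e)|>|h(e)|$ for every $e\in E$; put $l(e)=|t(e)|-|h(e)|$. Write $v>w$ if there is a directed path from $v$ to $w$; minimal and maximal vertices are meant with respect to this order. Let $A(\Gamma)$ be the quotient of the free associative $F$-algebra on generators $a_j(e)$ ($e\in E$, $1\le j\le l(e)$), with $\deg a_j(e)=j$, by the two-sided ideal generated by the coefficients of $P_{\pi_1}(t)-P_{\pi_2}(t)$, for all pairs of directed paths $\pi_1,\pi_2$ with the same tail and the same head, where $t$ is a central variable, $P_e(t)=1+\sum_{j=1}^{l(e)}(-1)^ja_j(e)t^j$, and $P_\pi(t)=P_{e_1}(t)\cdots P_{e_r}(t)$ for a path $\pi=(e_1,\dots,e_r)$. It is a graded algebra. A graded algebra $A$ is called a noncommutative complete intersection if it is isomorphic, as a graded algebra, to $T(V)/\langle R\rangle$ for some positively graded vector space $V$ with finite-dimensional homogeneous components and some graded subspace $R$ of the tensor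 algebra $T(V)$, such that the Hilbert series satisfy $$H(A,z)=\frac{1}{1-H(V,z)+H(R,z)}.$$ **Corollary 5.8.** Let $\Gamma_1$ and $\Gamma_2$ be generalized layered graphs with unique minimal vertices $v_{\min,1}$, $v_{\min,2}$ of level $0$ and unique maximal vertices $v_{\max,1}$, $v_{\max,2}$ of the same level $d$. Let $\Gamma_1\diamondsuit\Gamma_2$ (the double bouquet) be the generalized layered graph obtained from the disjoint union of $\Gamma_1$ and $\Gamma_2$ by identifying $v_{\min,1}$ with $v_{\min,2}$ and $v_{\max,1}$ with $v_{\max,2}$. If $A(\Gamma_1)$ and $A(\Gamma_2)$ are noncommutative complete intersections, then $A(\Gamma_1\diamondsuit\Gamma_2)$ is a noncommutative complete intersection. -/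

import Mathlib

open Polynomial

/-- A generalized layered graph with vertex set `V` and edge set `E`: a directed graph
(multiple edges are allowed) with a rank function that strictly decreases along every edge. -/
structure GenLayeredGraph (V : Type*) (E : Type*) where
  tail : E → V
  head : E → V
  rank : V → ℕ
  rank_head_lt : ∀ e, rank (head e) < rank (tail e)

/-- The degree `n` component of the free algebra `T(X)`, where the generator `x` has degree
`deg x`: the span of all words of total degree `n`. -/
def freeDegree (F : Type*) [Field F] {X : Type*} (deg : X → ℕ) (n : ℕ) :
    Submodule F (FreeAlgebra F X) :=
  Submodule.span F
    {y | ∃ w : List X, (w.map deg).sum = n ∧ y = (w.map (FreeAlgebra.ι F)).prod}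

/-- The graded dimension `∑ (dim M_n) z^n` of a family of subspaces, as a formal power series
(used only for finite-dimensional `M_n`). -/
noncomputable def gradedDim {F : Type*} [Field F] {A : Type*} [AddCommGroup A] [Module F A]
    (M : ℕ → Submodule F A) : PowerSeries ℤ :=
  PowerSeries.mk fun n => (Module.finrank F (M n) : ℤ)

/-- The algebra `A` with homogeneous components `𝒜 n` is a noncommutative complete intersection:
there are a positively graded, locally finite-dimensional space `V` and a graded subspace `R` of
the tensor algebra `T(V)` such that `A` is isomorphic, as a graded algebra, to `T(V)/⟨R⟩`, and
`H(A,z) = 1 / (1 - H(V,z) + H(R,z))`.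

`V` is given by a homogeneous basis `X`, so that `T(V)` is the free algebra on `X`; since `X` has
only finitely many elements of each degree it is countable, so `X : Type` is no restriction.
The isomorphism is given as a surjection `φ : T(V) → A` with kernel `⟨R⟩`. -/
def IsNCCompleteIntersection {F : Type*} [Field F] {A : Type*} [Ring A] [Algebra F A]
    (𝒜 : ℕ → Submodule F A) : Prop :=
  ∃ (X : Type) (deg : X → ℕ) (R : Submodule F (FreeAlgebra F X)) (φ : FreeAlgebra F X →ₐ[F] A),
    (∀ x, 0 < deg x) ∧
    (∀ n, {x | deg x = n}.Finite) ∧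
    -- `R` is a graded subspace
    R = ⨆ n, R ⊓ freeDegree F deg n ∧
    -- `φ` induces an isomorphism of graded algebras `T(V)/⟨R⟩ ≅ A`
    Function.Surjective φ ∧
    (∀ n, (freeDegree F deg n).map φ.toLinearMap = 𝒜 n) ∧
    TwoSidedIdeal.ker φ = TwoSidedIdeal.span (R : Set (FreeAlgebra F X)) ∧
    -- the Hilbert series identity
    gradedDim 𝒜 * (1 - PowerSeries.mk (fun n => ({x | deg x = n}.ncard : ℤ))
      + gradedDim (fun n => R ⊓ freeDegree F deg n)) = 1

namespace GenLayeredGraph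

variable {V E : Type*} (Γ : GenLayeredGraph V E)

/-- The length `l(e)` of an edge. -/
def len (e : E) : ℕ := Γ.rank (Γ.tail e) - Γ.rank (Γ.head e)

/-- `Γ.IsPath v w π`: the nonempty list of edges `π` is a directed path from `v` to `w`. -/
inductive IsPath : V → V → List E → Prop
  | single (e : E) : IsPath (Γ.tail e) (Γ.head e) [e]
  | cons (e : E) {w : V} {π : List E} (h : IsPath (Γ.head e) w π) :
      IsPath (Γ.tail e) w (e :: π)

/-- The order on vertices: `v > w` if there is a directed path from `v` to `w`. -/
def Above (v w : V) : Prop := ∃ π, Γ.IsPath v w π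

/-- `v` is the unique minimal vertex. -/
def IsUniqueMinimal (v : V) : Prop := ∀ u, (∀ w, ¬ Γ.Above u w) ↔ u = v

/-- `v` is the unique maximal vertex. -/
def IsUniqueMaximal (v : V) : Prop := ∀ u, (∀ w, ¬ Γ.Above w u) ↔ u = v

/-- The index set `E♯` of the generators `a_i(e)`, `1 ≤ i ≤ l(e)`. -/
def Gen : Type _ := {p : E × ℕ // 1 ≤ p.2 ∧ p.2 ≤ Γ.len p.1}

/-- The degree of `a_i(e)` is `i`. -/
def genDeg (g : Γ.Gen) : ℕ := g.1.2

section algebra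

variable (F : Type*) [Field F]

/-- `a_j(e)` as an element of the free algebra, with `a_0(e) = 1` (and `0` for `j > l(e)`). -/
noncomputable def a (e : E) (j : ℕ) : FreeAlgebra F Γ.Gen :=
  if h : 1 ≤ j ∧ j ≤ Γ.len e then FreeAlgebra.ι F (⟨(e, j), h⟩ : Γ.Gen)
  else if j = 0 then 1 else 0

/-- `P_e(t) = 1 + ∑_{j=1}^{l(e)} (-1)^j a_j(e) t^j`, with `t` a central variable. -/
noncomputable def edgePoly (e : E) : (FreeAlgebra F Γ.Gen)[X] :=
  1 + ∑ j ∈ Finset.Icc 1 (Γ.len e), C ((-1) ^ j * Γ.a F e j) * X ^ j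

/-- `P_π(t) = P_{e₁}(t) ⋯ P_{e_r}(t)` for `π = (e₁, …, e_r)`. -/
noncomputable def pathPoly (π : List E) : (FreeAlgebra F Γ.Gen)[X] :=
  (π.map (Γ.edgePoly F)).prod

/-- `e(π, j)`, defined by `P_π(t) = 1 + ∑_j (-1)^j e(π, j) t^j`. -/
noncomputable def pathCoeff (π : List E) (j : ℕ) : FreeAlgebra F Γ.Gen :=
  (-1) ^ j * (Γ.pathPoly F π).coeff j

/-- The defining relations `e(π₁, j) = e(π₂, j)`, `1 ≤ j ≤ l(π₁)`, for all pairs of paths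
`π₁`, `π₂` with the same tail and the same head. -/
inductive Rel : FreeAlgebra F Γ.Gen → FreeAlgebra F Γ.Gen → Prop
  | mk {v w : V} {π₁ π₂ : List E} (h₁ : Γ.IsPath v w π₁) (h₂ : Γ.IsPath v w π₂)
      {j : ℕ} (hj : 1 ≤ j) (hj' : j ≤ Γ.rank v - Γ.rank w) :
      Rel (Γ.pathCoeff F π₁ j) (Γ.pathCoeff F π₂ j)

/-- The algebra `A(Γ)` over `F`: the free algebra on `E♯` modulo the two-sided ideal generated by
the differences `e(π₁, j) - e(π₂, j)`. -/
abbrev Alg : Type _ := RingQuot (Γ.Rel F)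

/-- The homogeneous component `A(Γ)_[n]`: the image of the degree `n` part of the free algebra. -/
noncomputable def algDegree (n : ℕ) : Submodule F (Γ.Alg F) :=
  (freeDegree F Γ.genDeg n).map (RingQuot.mkAlgHom F (Γ.Rel F)).toLinearMap

end algebra

/-- The two identifications of vertices made in a double bouquet: `m₁ = m₂` and `M₁ = M₂`. -/
inductive Glue {V₁ V₂ : Type*} (m₁ M₁ : V₁) (m₂ M₂ : V₂) : V₁ ⊕ V₂ → V₁ ⊕ V₂ → Prop
  | min : Glue m₁ M₁ m₂ M₂ (Sum.inl m₁) (Sum.inr m₂)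
  | max : Glue m₁ M₁ m₂ M₂ (Sum.inl M₁) (Sum.inr M₂)

/-- The double bouquet `Γ₁ ◇ Γ₂`: the disjoint union of `Γ₁` and `Γ₂` with the vertex `m₁`
identified with `m₂` and the vertex `M₁` identified with `M₂` (vertices of equal ranks). -/
def doubleBouquet {V₁ E₁ V₂ E₂ : Type*} (Γ₁ : GenLayeredGraph V₁ E₁) (Γ₂ : GenLayeredGraph V₂ E₂)
    (m₁ M₁ : V₁) (m₂ M₂ : V₂) (hm : Γ₁.rank m₁ = Γ₂.rank m₂) (hM : Γ₁.rank M₁ = Γ₂.rank M₂) :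
    GenLayeredGraph (Quot (Glue m₁ M₁ m₂ M₂)) (E₁ ⊕ E₂) where
  tail e := Quot.mk _ (Sum.map Γ₁.tail Γ₂.tail e)
  head e := Quot.mk _ (Sum.map Γ₁.head Γ₂.head e)
  rank := Quot.lift (Sum.elim Γ₁.rank Γ₂.rank) (by
    rintro _ _ (_ | _)
    · exact hm
    · exact hM)
  rank_head_lt := by
    rintro (e | e)
    · exact Γ₁.rank_head_lt e
    · exact Γ₂.rank_head_lt e

end GenLayeredGraph

/-! Let c_1, …, c_d be the coefficients of P_π for a path π from the maximal to the minimal vertex.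
The minimal vertex has no outgoing edge and the maximal one no incoming edge, so every path of the
double bouquet stays in one of the two graphs. The only relations mixing the graphs therefore equate
the two families c_j, and A = A(Γ₁ ◇ Γ₂) is the pushout of A₁ = A(Γ₁) and A₂ = A(Γ₂) along the free
algebra on c_1, …, c_d (`exists_algHom_doubleBouquet`). Presentations of A₁ and A₂ combine to one of
A on V₁ ⊕ V₂, with relations R₁, R₂ and one difference in each degree 1, …, d. Put H = H(A), H_i =
H(A_i), D_i = 1/H_i and T = z + ⋯ + z^d; the claim becomes H D = 1 for D = D₁ + D₂ − 1 + T.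

This follows from two coefficientwise inequalities, without a normal form theorem for amalgams. The
lower bound H D ≥ 1 is the Golod–Shafarevich inequality (`coeff_one_le_golodShafarevich`), proved
with Fox derivatives.

For the upper bound, the c_j are left independent in each A_i
(`eq_zero_of_sum_mul_pathCoeff_eq_zero`), which is seen in a representation of A_i by matrices over
itself. Hence a graded complement N_i of ∑ A_i c_j has series H_i (1 − T). As the c_j lie in both
factors, they can be absorbed into whatever stands to their right, so modulo ∑ A c_j the algebra A
is spanned by alternating products from N₁ and N₂ (`le_altWords_sup`). Thus H (1 − T) ≤ G, where G
counts alternating words.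

Finally D G = 1 − T, so (H D − 1) G ≤ 0, while H D − 1 and G are nonnegative and G has constant term
1. This forces H D = 1 (`mul_eq_one_of_bounds`). -/

/-! ### The weighted grading of a free algebra. -/

section FreeDegree

variable {F : Type*} [Field F] {X : Type*} (deg : X → ℕ)

theorem ι_mem_freeDegree (x : X) : FreeAlgebra.ι F x ∈ freeDegree F deg (deg x) :=
  Submodule.subset_span ⟨[x], by simp, by simp⟩

instance freeDegree.gradedMonoid : SetLike.GradedMonoid (freeDegree F deg) where
  one_mem := Submodule.subset_span ⟨[], by simp, by simp⟩
  mul_mem := by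
    intro m n p q hp hq
    have h : freeDegree F deg m * freeDegree F deg n ≤ freeDegree F deg (m + n) := by
      rw [freeDegree, freeDegree, Submodule.span_mul_span, Submodule.span_le]
      rintro _ ⟨_, ⟨u, hu, rfl⟩, _, ⟨v, hv, rfl⟩, rfl⟩
      exact Submodule.subset_span ⟨u ++ v, by simp [hu, hv], by simp⟩
    exact h (Submodule.mul_mem_mul hp hq)

instance gradedMonoid_map {A B : Type*} [Ring A] [Algebra F A] [Ring B] [Algebra F B]
    (𝒜 : ℕ → Submodule F A) [SetLike.GradedMonoid 𝒜] (f : A →ₐ[F] B) :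
    SetLike.GradedMonoid fun n => (𝒜 n).map f.toLinearMap where
  one_mem := ⟨1, SetLike.GradedOne.one_mem, by simp⟩
  mul_mem := by
    rintro m n _ _ ⟨p, hp, rfl⟩ ⟨q, hq, rfl⟩
    exact ⟨p * q, SetLike.GradedMul.mul_mem hp hq, by simp⟩

theorem map_freeDegree_le {A : Type*} [Ring A] [Algebra F A] (𝒜 : ℕ → Submodule F A)
    [SetLike.GradedMonoid 𝒜] (f : FreeAlgebra F X →ₐ[F] A)
    (hf : ∀ x, f (FreeAlgebra.ι F x) ∈ 𝒜 (deg x)) (n : ℕ) :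
    (freeDegree F deg n).map f.toLinearMap ≤ 𝒜 n := by
  rw [freeDegree, Submodule.map_span_le]
  rintro _ ⟨w, rfl, rfl⟩
  have := SetLike.list_prod_map_mem_graded (A := 𝒜) w deg (fun x => f (FreeAlgebra.ι F x))
    fun x _ => hf x
  simpa [map_list_prod, Function.comp_def] using this

theorem iSup_freeDegree : ⨆ n, freeDegree F deg n = ⊤ := by
  rw [eq_top_iff]
  rintro f -
  induction f using FreeAlgebra.induction with
  | grade0 r =>
    rw [Algebra.algebraMap_eq_smul_one]
    exact Submodule.smul_mem _ _
      (Submodule.mem_iSup_of_mem 0 (SetLike.GradedOne.one_mem (A := freeDegree F deg)))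
  | grade1 x => exact Submodule.mem_iSup_of_mem _ (ι_mem_freeDegree deg x)
  | add f g hf hg => exact add_mem hf hg
  | mul f g hf hg =>
    have h : (⨆ n, freeDegree F deg n) * (⨆ n, freeDegree F deg n) ≤ ⨆ n, freeDegree F deg n := by
      simp only [Submodule.iSup_mul, Submodule.mul_iSup, iSup_le_iff, Submodule.mul_le]
      exact fun i j p hp q hq => Submodule.mem_iSup_of_mem (j + i)
        (SetLike.GradedMul.mul_mem hp hq)
    exact h (Submodule.mul_mem_mul hf hg)

variable {deg}

theorem finite_words (hpos : ∀ x, 0 < deg x) (hfin : ∀ n, {x | deg x = n}.Finite) (n : ℕ) :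
    {w : List X | (w.map deg).sum = n}.Finite := by
  induction n using Nat.strong_induction_on with
  | _ n ih =>
    have h : (⋃ k ∈ Set.Icc 1 n, ⋃ x ∈ {x | deg x = k},
        List.cons x '' {w : List X | (w.map deg).sum = n - k}).Finite := by
      refine (Set.finite_Icc 1 n).biUnion fun k hk => (hfin k).biUnion fun x _ => ?_
      exact (ih (n - k) (by have := hk.1; have := hk.2; omega)).image _
    refine (h.union (Set.finite_singleton [])).subset ?_
    rintro (_ | ⟨x, w⟩) hw
    · simp
    · left
      have := hpos x
      simp only [List.map_cons, List.sum_cons, Set.mem_ofPred_eq] at hw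
      simp only [Set.mem_iUnion, Set.mem_image, Set.mem_ofPred_eq, Set.mem_Icc]
      exact ⟨deg x, ⟨by omega, by omega⟩, x, rfl, w, by omega, rfl⟩

theorem finiteDimensional_freeDegree (hpos : ∀ x, 0 < deg x)
    (hfin : ∀ n, {x | deg x = n}.Finite) (n : ℕ) :
    FiniteDimensional F (freeDegree F deg n) := by
  refine FiniteDimensional.span_of_finite F
    (((finite_words hpos hfin n).image fun w => (w.map (FreeAlgebra.ι F)).prod).subset ?_)
  rintro _ ⟨w, hw, rfl⟩
  exact ⟨w, hw, rfl⟩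

theorem freeDegree_zero (hpos : ∀ x, 0 < deg x) : freeDegree F deg 0 = 1 := by
  apply le_antisymm
  · rw [freeDegree, Submodule.span_le]
    rintro _ ⟨w, hw, rfl⟩
    rcases w with _ | ⟨x, w⟩
    · simp
    · have := hpos x
      simp only [List.map_cons, List.sum_cons] at hw
      omega
  · exact Submodule.one_le.2 (SetLike.GradedOne.one_mem (A := freeDegree F deg))

variable (F deg) in
/-- The homomorphism `x ↦ x t ^ deg x`, whose coefficients are the homogeneous components. -/
noncomputable def degreeHom : FreeAlgebra F X →ₐ[F] (FreeAlgebra F X)[X] :=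
  FreeAlgebra.lift F fun x => monomial (deg x) (FreeAlgebra.ι F x)

theorem coeff_degreeHom_mem (f : FreeAlgebra F X) (n : ℕ) :
    (degreeHom F deg f).coeff n ∈ freeDegree F deg n := by
  induction f using FreeAlgebra.induction generalizing n with
  | grade0 r =>
    rw [AlgHom.commutes, Polynomial.algebraMap_apply, coeff_C]
    split_ifs with h
    · subst h
      rw [Algebra.algebraMap_eq_smul_one]
      exact Submodule.smul_mem _ _ (SetLike.GradedOne.one_mem (A := freeDegree F deg))
    · exact zero_mem _
  | grade1 x =>
    rw [degreeHom, FreeAlgebra.lift_ι_apply, coeff_monomial]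
    split_ifs with h
    · exact h ▸ ι_mem_freeDegree deg x
    · exact zero_mem _
  | add f g hf hg => simpa using add_mem (hf n) (hg n)
  | mul f g hf hg =>
    rw [map_mul, coeff_mul]
    refine Submodule.sum_mem _ fun p hp => ?_
    rw [← Finset.HasAntidiagonal.mem_antidiagonal.1 hp]
    exact SetLike.GradedMul.mul_mem (hf _) (hg _)

theorem degreeHom_of_mem {n : ℕ} {f : FreeAlgebra F X} (hf : f ∈ freeDegree F deg n) :
    degreeHom F deg f = monomial n f := by
  induction hf using Submodule.span_induction with
  | mem f hf =>
    obtain ⟨w, rfl, rfl⟩ := hf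
    induction w with
    | nil => simp
    | cons x w ih =>
      rw [List.map_cons, List.prod_cons, map_mul, ih, degreeHom, FreeAlgebra.lift_ι_apply,
        monomial_mul_monomial]
      simp
  | zero => simp
  | add f g _ _ hf hg => simp [hf, hg]
  | smul a f _ hf => rw [map_smul, hf, smul_monomial]

theorem coeff_degreeHom_mem_of_graded {R : Submodule F (FreeAlgebra F X)}
    (hR : R = ⨆ n, R ⊓ freeDegree F deg n) {r : FreeAlgebra F X} (hr : r ∈ R) (n : ℕ) :
    (degreeHom F deg r).coeff n ∈ R ⊓ freeDegree F deg n := by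
  rw [hR] at hr
  induction hr using Submodule.iSup_induction' with
  | mem i x hx =>
    rw [degreeHom_of_mem hx.2, coeff_monomial]
    split_ifs with h
    · exact h ▸ hx
    · exact zero_mem _
  | zero => simp
  | add x y _ _ hx hy => simpa using add_mem hx hy

end FreeDegree

/-! ### Dimension bounds for products and finite sums of subspaces. -/

section Dimension

variable {F : Type*} [Field F]

/-- The image is the range of a linear map on p ⊗ q. -/
theorem finrank_map₂_le {M N P : Type*} [AddCommGroup M] [Module F M] [AddCommGroup N]
    [Module F N] [AddCommGroup P] [Module F P] (f : M →ₗ[F] N →ₗ[F] P) (p : Submodule F M)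
    (q : Submodule F N) [FiniteDimensional F p] [FiniteDimensional F q] :
    Module.finrank F (Submodule.map₂ f p q) ≤ Module.finrank F p * Module.finrank F q := by
  rw [TensorProduct.map₂_eq_range_lift_comp_mapIncl, ← Module.finrank_tensorProduct]
  exact LinearMap.finrank_range_le _

instance finiteDimensional_map₂ {M N P : Type*} [AddCommGroup M] [Module F M] [AddCommGroup N]
    [Module F N] [AddCommGroup P] [Module F P] (f : M →ₗ[F] N →ₗ[F] P) (p : Submodule F M)
    (q : Submodule F N) [FiniteDimensional F p] [FiniteDimensional F q] :
    FiniteDimensional F (Submodule.map₂ f p q) := by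
  rw [TensorProduct.map₂_eq_range_lift_comp_mapIncl]
  infer_instance

theorem finrank_finset_sup_le {M ι : Type*} [AddCommGroup M] [Module F M] (s : Finset ι)
    (p : ι → Submodule F M) [∀ i, FiniteDimensional F (p i)] :
    Module.finrank F ↥(s.sup p) ≤ ∑ i ∈ s, Module.finrank F (p i) := by
  classical
  induction s using Finset.induction_on with
  | empty => rw [Finset.sup_empty, finrank_bot]; simp
  | insert i s hi ih =>
    have := Submodule.finiteDimensional_finset_sup s p
    rw [Finset.sup_insert, Finset.sum_insert hi]
    exact (Submodule.finrank_add_le_finrank_add_finrank _ _).trans (by gcongr)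

end Dimension

/-! ### Fox derivatives. -/

section Fox

variable {F : Type*} [Field F] {X : Type*} {A : Type*} [Ring A] [Algebra F A]
  {M : Type*} [AddCommGroup M] [Module F M] [Module A M] [IsScalarTower F A M]
  [SMulCommClass A F M]

/-- The representation of the free algebra on `M × F` in which `x` maps `(m, c)` to
`(φ x • m + c • e x, 0)`. -/
noncomputable def foxHom (φ : FreeAlgebra F X →ₐ[F] A) (e : X → M) :
    FreeAlgebra F X →ₐ[F] Module.End F (M × F) :=
  FreeAlgebra.lift F fun x =>
    LinearMap.inl F M F ∘ₗ ((Algebra.lsmul F F M (φ (FreeAlgebra.ι F x))).coprod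
      (LinearMap.toSpanSingleton F M (e x)))

/-- The Fox derivative `f ↦ ∑ ∂f/∂x • e x`, where `f = ε(f) + ∑ (∂f/∂x) x`. -/
noncomputable def fox (φ : FreeAlgebra F X →ₐ[F] A) (e : X → M) : FreeAlgebra F X →ₗ[F] M :=
  LinearMap.fst F M F ∘ₗ (LinearMap.applyₗ ((0 : M), (1 : F))) ∘ₗ (foxHom φ e).toLinearMap

theorem fox_apply (φ : FreeAlgebra F X →ₐ[F] A) (e : X → M) (f : FreeAlgebra F X) :
    fox φ e f = (foxHom φ e f (0, 1)).1 := rfl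

/-- The operators are block triangular, with `φ` and the augmentation on the diagonal and the Fox
derivative off it; multiplicativity of the representation is thus the product rule. -/
theorem foxHom_apply (φ : FreeAlgebra F X →ₐ[F] A) (e : X → M) (f : FreeAlgebra F X) (m : M)
    (c : F) :
    foxHom φ e f (m, c) = (φ f • m + c • fox φ e f, FreeAlgebra.algebraMapInv f * c) := by
  induction f using FreeAlgebra.induction generalizing m c with
  | grade0 r =>
    simp [fox_apply, FreeAlgebra.algebraMapInv]
  | grade1 x =>
    simp [fox_apply, foxHom, FreeAlgebra.algebraMapInv]
  | add f g hf hg =>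
    rw [fox_apply, map_add, LinearMap.add_apply, LinearMap.add_apply, hf, hg, hf, hg]
    simp only [Prod.mk_add_mk, map_add, smul_zero, zero_add, one_smul, Prod.mk.injEq]
    constructor
    · rw [add_smul, smul_add]
      abel
    · ring
  | mul f g hf hg =>
    rw [fox_apply, map_mul, Module.End.mul_apply, Module.End.mul_apply, hg, hf, hg, hf]
    simp only [map_mul, smul_zero, zero_add, one_smul, mul_one, Prod.mk.injEq, smul_add, mul_smul,
      mul_assoc, and_true]
    rw [smul_comm c (φ f), smul_comm c (FreeAlgebra.algebraMapInv g)]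
    abel

variable (φ : FreeAlgebra F X →ₐ[F] A) (e : X → M)

@[simp]
theorem fox_ι (x : X) : fox φ e (FreeAlgebra.ι F x) = e x := by
  simp [fox_apply, foxHom]

theorem fox_mul (f g : FreeAlgebra F X) :
    fox φ e (f * g) = φ f • fox φ e g + FreeAlgebra.algebraMapInv g • fox φ e f := by
  rw [fox_apply, map_mul, Module.End.mul_apply, foxHom_apply, foxHom_apply]
  simp

end Fox

/-! ### The Golod–Shafarevich inequality. -/

section GolodShafarevich

variable {F : Type*} [Field F] {X : Type*} {deg : X → ℕ} {A : Type*} [Ring A] [Algebra F A]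

theorem algebraMapInv_eq_zero_of_pos {n : ℕ} (hn : 0 < n)
    {f : FreeAlgebra F X} (hf : f ∈ freeDegree F deg n) : FreeAlgebra.algebraMapInv f = 0 := by
  induction hf using Submodule.span_induction with
  | mem f hf =>
    obtain ⟨w, hw, rfl⟩ := hf
    rcases w with _ | ⟨x, w⟩
    · simp at hw; omega
    · simp [FreeAlgebra.algebraMapInv]
  | zero => simp
  | add f g _ _ hf hg => simp [hf, hg]
  | smul a f _ hf => simp [hf]

theorem algebraMapInv_eq_zero_of_graded [Nontrivial A] (hpos : ∀ x, 0 < deg x)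
    {φ : FreeAlgebra F X →ₐ[F] A} {n : ℕ} {f : FreeAlgebra F X} (hf : f ∈ freeDegree F deg n)
    (hφ : φ f = 0) : FreeAlgebra.algebraMapInv f = 0 := by
  rcases Nat.eq_zero_or_pos n with rfl | hn
  · rw [freeDegree_zero hpos, Submodule.mem_one] at hf
    obtain ⟨c, rfl⟩ := hf
    rw [AlgHom.commutes] at hφ
    have : c = 0 := (algebraMap F A).injective (by rw [hφ, map_zero])
    simp [this]
  · exact algebraMapInv_eq_zero_of_pos hn hf

/-- Both `φ` and the augmentation ε kill homogeneous relations, so the product rule reduces the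
derivative of a r b to ε(b) φ(a) • ∂r. The derivatives of the ideal are therefore A-combinations of
derivatives of relations. -/
theorem fox_coeff_degreeHom_mem [Nontrivial A] (hpos : ∀ x, 0 < deg x)
    {R : Submodule F (FreeAlgebra F X)} (hR : R = ⨆ n, R ⊓ freeDegree F deg n)
    {φ : FreeAlgebra F X →ₐ[F] A} (hφR : ∀ r ∈ R, φ r = 0)
    {M : Type*} [AddCommGroup M] [Module F M] [Module A M] [IsScalarTower F A M]
    [SMulCommClass A F M] (e : X → M) {f : FreeAlgebra F X}
    (hf : f ∈ TwoSidedIdeal.span (R : Set (FreeAlgebra F X))) (n : ℕ) :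
    fox φ e ((degreeHom F deg f).coeff n) ∈ (Finset.HasAntidiagonal.antidiagonal n).sup fun p =>
      Submodule.map₂ (Algebra.lsmul F F M).toLinearMap
        ((freeDegree F deg p.1).map φ.toLinearMap)
        ((R ⊓ freeDegree F deg p.2).map (fox φ e)) := by
  rw [TwoSidedIdeal.mem_span_iff_mem_addSubgroup_closure] at hf
  induction hf using AddSubgroup.closure_induction with
  | mem f hf =>
    obtain ⟨_, ⟨a, -, r, hr, rfl⟩, b, -, rfl⟩ := hf
    simp only [map_mul, coeff_mul, map_sum, Finset.sum_mul]
    refine Submodule.sum_mem _ fun p hp => Submodule.sum_mem _ fun q hq => ?_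
    rw [Finset.HasAntidiagonal.mem_antidiagonal] at hp hq
    have hrq := coeff_degreeHom_mem_of_graded hR hr q.2
    have hφ := hφR _ hrq.1
    have hε := algebraMapInv_eq_zero_of_graded hpos hrq.2 hφ
    rw [fox_mul, fox_mul, map_mul, hφ, hε, mul_zero, zero_smul, zero_smul, zero_add, add_zero]
    -- Only the degree 0 part of the right factor b has nonzero augmentation.
    rcases Nat.eq_zero_or_pos p.2 with h0 | h0
    · refine Submodule.smul_mem _ _ (Finset.le_sup (f := fun p : ℕ × ℕ =>
        Submodule.map₂ (Algebra.lsmul F F M).toLinearMap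
        ((freeDegree F deg p.1).map φ.toLinearMap)
        ((R ⊓ freeDegree F deg p.2).map (fox φ e)))
        (Finset.HasAntidiagonal.mem_antidiagonal.2 (by omega : q.1 + q.2 = n)) ?_)
      exact Submodule.apply_mem_map₂ (Algebra.lsmul F F M).toLinearMap
        ⟨_, coeff_degreeHom_mem a _, rfl⟩ ⟨_, hrq, rfl⟩
    · rw [algebraMapInv_eq_zero_of_pos h0 (coeff_degreeHom_mem b _), zero_smul]
      exact zero_mem _
  | zero => simp
  | add f g _ _ hf hg => simpa using add_mem hf hg
  | neg f _ hf => simpa using hf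

theorem sum_eq_coeff_mul_ncard (a : ℕ → ℤ) (n : ℕ)
    (s : Finset X) (hs : ∀ x, x ∈ s ↔ deg x ≤ n) :
    ∑ x ∈ s, a (n - deg x) = PowerSeries.coeff n (PowerSeries.mk a *
      PowerSeries.mk fun n => ({x | deg x = n}.ncard : ℤ)) := by
  classical
  rw [PowerSeries.coeff_mul, ← Finset.Nat.sum_antidiagonal_swap,
    Finset.Nat.sum_antidiagonal_eq_sum_range_succ_mk,
    ← Finset.sum_fiberwise_of_maps_to (g := deg) (t := Finset.range n.succ)
      (fun x hx => by simpa [Nat.lt_succ_iff] using (hs x).1 hx)]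
  refine Finset.sum_congr rfl fun k hk => ?_
  rw [Finset.sum_congr rfl fun x hx => by rw [(Finset.mem_filter.1 hx).2], Finset.sum_const]
  have : {x | deg x = k} = ((s.filter fun x => deg x = k : Finset X) : Set X) := by
    ext x
    simp only [Set.mem_ofPred_eq, Finset.coe_filter, hs]
    have := Finset.mem_range.1 hk
    constructor
    · rintro rfl; exact ⟨by omega, rfl⟩
    · exact fun h => h.2
  simp only [Prod.fst_swap, Prod.snd_swap, PowerSeries.coeff_mk, this, Set.ncard_coe_finset,
    nsmul_eq_mul]
  ring

/-- The Golod–Shafarevich inequality `H(A,z) (1 - H(V,z) + H(R,z)) ≥ 1`. -/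
theorem coeff_one_le_golodShafarevich [Nontrivial A] (𝒜 : ℕ → Submodule F A)
    (hpos : ∀ x, 0 < deg x) (hfin : ∀ n, {x | deg x = n}.Finite)
    (R : Submodule F (FreeAlgebra F X)) (hR : R = ⨆ n, R ⊓ freeDegree F deg n)
    (φ : FreeAlgebra F X →ₐ[F] A)
    (h𝒜 : ∀ n, (freeDegree F deg n).map φ.toLinearMap = 𝒜 n)
    (hker : TwoSidedIdeal.ker φ = TwoSidedIdeal.span (R : Set (FreeAlgebra F X))) (n : ℕ) :
    PowerSeries.coeff n (1 : PowerSeries ℤ) ≤ PowerSeries.coeff n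
      (gradedDim 𝒜 * (1 - PowerSeries.mk (fun n => ({x | deg x = n}.ncard : ℤ))
        + gradedDim (fun n => R ⊓ freeDegree F deg n))) := by
  classical
  have fdT := finiteDimensional_freeDegree (F := F) hpos hfin
  have fdA : ∀ n, FiniteDimensional F (𝒜 n) := fun n => by rw [← h𝒜]; infer_instance
  have fdR : ∀ n, FiniteDimensional F ↥(R ⊓ freeDegree F deg n) := fun n =>
    Submodule.finiteDimensional_inf_right _ _
  have gm : SetLike.GradedMonoid 𝒜 := by
    rw [← funext h𝒜]; infer_instance
  have hφR : ∀ r ∈ R, φ r = 0 := fun r hr => by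
    rw [← TwoSidedIdeal.mem_ker, hker]
    exact TwoSidedIdeal.subset_span hr
  set s : Finset X := (((Set.finite_Iic n).biUnion fun k _ => hfin k).toFinset) with hs
  have hs' : ∀ x, x ∈ s ↔ deg x ≤ n := fun x => by simp [hs]
  -- The degree n coefficient of the inequality; for n > 0 it is rank–nullity for the map (u_x) ↦ ∑
  -- u_x x into A_n.
  have key : (∑ x ∈ s, (Module.finrank F (𝒜 (n - deg x)) : ℤ)) +
      PowerSeries.coeff n (1 : PowerSeries ℤ) ≤ Module.finrank F (𝒜 n) +
      ∑ p ∈ Finset.HasAntidiagonal.antidiagonal n, (Module.finrank F (𝒜 p.1) : ℤ) *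
        Module.finrank F ↥(R ⊓ freeDegree F deg p.2) := by
    rcases Nat.eq_zero_or_pos n with rfl | hn
    · have h1 : s = ∅ := Finset.eq_empty_of_forall_notMem fun x hx => by
        have := (hs' x).1 hx; have := hpos x; omega
      have h2 : 0 < Module.finrank F (𝒜 0) := by
        rw [Module.finrank_pos_iff_exists_ne_zero]
        exact ⟨⟨1, gm.one_mem⟩, fun h => one_ne_zero (congrArg Subtype.val h)⟩
      simp only [h1, Finset.sum_empty, zero_add, PowerSeries.coeff_one, if_true]
      have : (0:ℤ) ≤ ∑ p ∈ Finset.HasAntidiagonal.antidiagonal 0, (Module.finrank F (𝒜 p.1) : ℤ) *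
        Module.finrank F ↥(R ⊓ freeDegree F deg p.2) := by positivity
      omega
    · rw [PowerSeries.coeff_one, if_neg hn.ne', add_zero]
      let D := (x : s) → 𝒜 (n - deg x)
      let incl : D →ₗ[F] (s → A) := LinearMap.pi fun x => (𝒜 (n - deg x)).subtype ∘ₗ
        LinearMap.proj x
      have hincl : Function.Injective incl := fun u v h => by
        ext x; exact congrFun h x
      let S : D →ₗ[F] A := ∑ x : s, LinearMap.mulRight F (φ (FreeAlgebra.ι F x.1)) ∘ₗ
        LinearMap.proj x ∘ₗ incl
      have hS : ∀ u, S u = ∑ x : s, (u x : A) * φ (FreeAlgebra.ι F x.1) := fun u => by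
        simp [S, incl]
        rfl
      -- With these values the Fox derivative reads off the left coefficient of each last letter x.
      -- Generators of degree above n are sent to 0; they do not enter the sums below.
      let e : X → (s → A) := fun x => if h : x ∈ s then Pi.single ⟨x, h⟩ 1 else 0
      have hrange : LinearMap.range S ≤ 𝒜 n := by
        rintro _ ⟨u, rfl⟩
        rw [hS]
        refine Submodule.sum_mem _ fun x _ => ?_
        have hx := (hs' x.1).1 x.2
        have : φ (FreeAlgebra.ι F x.1) ∈ 𝒜 (deg x.1) := by
          rw [← h𝒜]; exact ⟨_, ι_mem_freeDegree deg x.1, rfl⟩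
        have := gm.mul_mem (u x).2 this
        rwa [Nat.sub_add_cancel hx] at this
      -- A syzygy u lifts to ∑ f_x x in the ideal of relations, and the Fox derivative of this
      -- element is u again.
      have hker' : (LinearMap.ker S).map incl ≤ (Finset.HasAntidiagonal.antidiagonal n).sup fun p =>
          Submodule.map₂ (Algebra.lsmul F F (s → A)).toLinearMap
            ((freeDegree F deg p.1).map φ.toLinearMap)
            ((R ⊓ freeDegree F deg p.2).map (fox φ e)) := by
        rintro _ ⟨u, hu, rfl⟩
        have hlift : ∀ x : s, ∃ f ∈ freeDegree F deg (n - deg x), φ f = u x := fun x => by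
          exact (h𝒜 (n - deg x)).ge (u x).2
        choose f hf hfu using hlift
        have hsum : ∑ x : s, f x * FreeAlgebra.ι F x.1 ∈ freeDegree F deg n := by
          refine Submodule.sum_mem _ fun x _ => ?_
          have := SetLike.GradedMul.mul_mem (hf x) (ι_mem_freeDegree (F := F) deg x.1)
          rwa [Nat.sub_add_cancel ((hs' x.1).1 x.2)] at this
        have hI : ∑ x : s, f x * FreeAlgebra.ι F x.1 ∈
            TwoSidedIdeal.span (R : Set (FreeAlgebra F X)) := by
          rw [← hker, TwoSidedIdeal.mem_ker, ← LinearMap.mem_ker.1 hu, hS]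
          simp [hfu]
        have := fox_coeff_degreeHom_mem hpos hR hφR e hI n
        rw [degreeHom_of_mem hsum, coeff_monomial, if_pos rfl] at this
        convert this using 1
        rw [map_sum]
        ext y
        rw [Finset.sum_apply, Finset.sum_eq_single y]
        · simp [fox_mul, FreeAlgebra.algebraMapInv, e, hfu, incl]
          rfl
        · intro x _ hx
          simp [fox_mul, FreeAlgebra.algebraMapInv, e, hfu, hx.symm]
        · simp
      have h1 : Module.finrank F D = ∑ x ∈ s, Module.finrank F (𝒜 (n - deg x)) := by
        rw [Module.finrank_pi_fintype, Finset.sum_coe_sort s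
          fun x => Module.finrank F (𝒜 (n - deg x))]
      have h2 : Module.finrank F (LinearMap.range S) ≤ Module.finrank F (𝒜 n) :=
        Submodule.finrank_mono hrange
      have h3 : Module.finrank F (LinearMap.ker S) ≤
          ∑ p ∈ Finset.HasAntidiagonal.antidiagonal n, Module.finrank F (𝒜 p.1) *
            Module.finrank F ↥(R ⊓ freeDegree F deg p.2) := by
        rw [(Submodule.equivMapOfInjective incl hincl (LinearMap.ker S)).finrank_eq]
        refine (Submodule.finrank_mono hker').trans ((finrank_finset_sup_le _ _).trans ?_)
        refine Finset.sum_le_sum fun p _ => (finrank_map₂_le _ _ _).trans ?_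
        rw [h𝒜]
        gcongr
        exact Submodule.finrank_map_le _ _
      have h4 := LinearMap.finrank_range_add_finrank_ker S
      rw [h1] at h4
      have : ∑ x ∈ s, Module.finrank F (𝒜 (n - deg x)) ≤ Module.finrank F (𝒜 n) +
        ∑ p ∈ Finset.HasAntidiagonal.antidiagonal n, Module.finrank F (𝒜 p.1) *
            Module.finrank F ↥(R ⊓ freeDegree F deg p.2) := by omega
      exact_mod_cast this
  have e1 := sum_eq_coeff_mul_ncard (fun k => (Module.finrank F (𝒜 k) : ℤ)) n s hs'
  rw [mul_add, mul_sub, mul_one, map_add, map_sub]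
  have e2 : PowerSeries.coeff n (gradedDim 𝒜) = Module.finrank F (𝒜 n) := by
    simp [gradedDim]
  have e3 : PowerSeries.coeff n (gradedDim 𝒜 * gradedDim (fun n => R ⊓ freeDegree F deg n)) =
      ∑ p ∈ Finset.HasAntidiagonal.antidiagonal n, (Module.finrank F (𝒜 p.1) : ℤ) *
        Module.finrank F ↥(R ⊓ freeDegree F deg p.2) := by
    simp [gradedDim, PowerSeries.coeff_mul]
  have e4 : gradedDim 𝒜 = PowerSeries.mk fun k => (Module.finrank F (𝒜 k) : ℤ) := rfl
  rw [e2, e3, e4]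
  linarith

end GolodShafarevich

/-! ### Spanning an amalgam by alternating words. -/

section AlternatingWords

variable {F : Type*} [Field F] {A : Type*} [Ring A] [Algebra F A]

theorem finrank_submodule_mul_le (p q : Submodule F A) [FiniteDimensional F p]
    [FiniteDimensional F q] :
    Module.finrank F ↥(p * q) ≤ Module.finrank F p * Module.finrank F q := by
  rw [Submodule.mul_eq_map₂]
  exact finrank_map₂_le _ _ _

theorem finiteDimensional_submodule_mul (p q : Submodule F A) [FiniteDimensional F p]
    [FiniteDimensional F q] : FiniteDimensional F ↥(p * q) := by
  rw [Submodule.mul_eq_map₂]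
  infer_instance

/-- The degree `n` part of the span of `1` and the alternating products
`⋯ N (!b) * N b * N (!b) * N b` of positive degree factors. -/
noncomputable def altWords (N : Bool → ℕ → Submodule F A) : Bool → ℕ → Submodule F A
  | b, n => if n = 0 then 1 else
      Finset.univ.sup fun p : Fin n => altWords N (!b) p * N b (n - p)
termination_by _ n => n

/-- The numerical bound for the dimension of `altWords`. -/
def altCount (ν : Bool → ℕ → ℕ) : Bool → ℕ → ℕ
  | b, n => if n = 0 then 1 else ∑ p : Fin n, altCount ν (!b) p * ν b (n - p)
termination_by _ n => n

theorem altCount_zero (ν : Bool → ℕ → ℕ) (b : Bool) : altCount ν b 0 = 1 := by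
  rw [altCount, if_pos rfl]

theorem altWords_zero (N : Bool → ℕ → Submodule F A) (b : Bool) : altWords N b 0 = 1 := by
  rw [altWords, if_pos rfl]

theorem altWords_of_pos (N : Bool → ℕ → Submodule F A) (b : Bool) {n : ℕ} (hn : n ≠ 0) :
    altWords N b n = Finset.univ.sup fun p : Fin n => altWords N (!b) p * N b (n - p) := by
  rw [altWords, if_neg hn]

theorem finrank_altWords_le (N : Bool → ℕ → Submodule F A)
    [∀ b n, FiniteDimensional F (N b n)] (ν : Bool → ℕ → ℕ)
    (hν : ∀ b n, n ≠ 0 → Module.finrank F (N b n) ≤ ν b n) (b : Bool) (n : ℕ) :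
    FiniteDimensional F (altWords N b n) ∧
      Module.finrank F (altWords N b n) ≤ altCount ν b n := by
  induction n using Nat.strong_induction_on generalizing b with
  | _ n ih =>
    rcases eq_or_ne n 0 with rfl | hn
    · rw [altWords_zero, altCount_zero, Submodule.one_eq_span]
      exact ⟨inferInstance, (finrank_span_le_card ({1} : Set A)).trans (by simp)⟩
    · rw [altWords_of_pos N b hn, altCount, if_neg hn]
      have fd : ∀ p : Fin n, FiniteDimensional F ↥(altWords N (!b) p * N b (n - p)) := fun p => by
        have := (ih p p.2 (!b)).1
        exact finiteDimensional_submodule_mul _ _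
      refine ⟨Submodule.finiteDimensional_finset_sup _ _, (finrank_finset_sup_le _ _).trans ?_⟩
      refine Finset.sum_le_sum fun p _ => ?_
      have := (ih p p.2 (!b)).1
      exact (finrank_submodule_mul_le _ _).trans
        (Nat.mul_le_mul (ih p p.2 (!b)).2 (hν _ _ (by omega)))

/-- The degree `n` part of `∑ j, ℬ c_j`. -/
noncomputable def rightMultiples (ℬ : ℕ → Submodule F A) (d : ℕ) (c : ℕ → A) (n : ℕ) :
    Submodule F A :=
  (Finset.Icc 1 (min d n)).sup fun j => (ℬ (n - j)).map (LinearMap.mulRight F (c j))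

theorem mul_mem_rightMultiples {ℬ : ℕ → Submodule F A} {d : ℕ} {c : ℕ → A} {n j : ℕ}
    (hj : j ∈ Finset.Icc 1 (min d n)) {x : A} (hx : x ∈ ℬ (n - j)) :
    x * c j ∈ rightMultiples ℬ d c n :=
  Finset.le_sup (f := fun j => (ℬ (n - j)).map (LinearMap.mulRight F (c j))) hj ⟨x, hx, rfl⟩

section Spanning

variable {𝒜 : ℕ → Submodule F A} [SetLike.GradedMonoid 𝒜] {ℬ N : Bool → ℕ → Submodule F A}
  {d : ℕ} {c : ℕ → A}

theorem altWords_le (hN𝒜 : ∀ b n, N b n ≤ 𝒜 n) (b : Bool) (n : ℕ) : altWords N b n ≤ 𝒜 n := by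
  induction n using Nat.strong_induction_on generalizing b with
  | _ n ih =>
    rw [altWords]
    split_ifs with hn
    · subst hn
      exact Submodule.one_le.2 SetLike.GradedOne.one_mem
    · refine Finset.sup_le fun p _ => Submodule.mul_le.2 fun x hx y hy => ?_
      have := SetLike.GradedMul.mul_mem (ih p p.2 _ hx) (hN𝒜 _ _ hy)
      rwa [Nat.add_sub_cancel' p.2.le] at this

/-- Split the new factor into its `N b` part, which extends the word, and its part in the left
multiples of the `c j`, which stays there after multiplication from the left. -/
theorem altWords_mul_le (hℬ𝒜 : ∀ b n, ℬ b n ≤ 𝒜 n) (hN𝒜 : ∀ b n, N b n ≤ 𝒜 n)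
    (hN : ∀ b n, n ≠ 0 → ℬ b n ≤ N b n ⊔ rightMultiples (ℬ b) d c n)
    (b : Bool) (p q : ℕ) (hq : q ≠ 0) :
    altWords N (!b) p * ℬ b q ≤ (⨆ b, altWords N b (p + q)) ⊔ rightMultiples 𝒜 d c (p + q) := by
  refine (mul_le_mul' le_rfl (hN b q hq)).trans ?_
  rw [Submodule.mul_sup]
  apply sup_le_sup
  · refine le_trans ?_ (le_iSup _ b)
    rw [altWords_of_pos N b (n := p + q) (by omega)]
    have := Finset.le_sup (f := fun k : Fin (p + q) => altWords N (!b) k * N b (p + q - k))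
      (Finset.mem_univ ⟨p, by omega⟩)
    simpa only [Nat.add_sub_cancel_left] using this
  · rw [Submodule.mul_le]
    intro x hx y hy
    have h : rightMultiples (ℬ b) d c q ≤
        (rightMultiples 𝒜 d c (p + q)).comap (LinearMap.mulLeft F x) := by
      refine Finset.sup_le fun j hj => ?_
      rintro _ ⟨z, hz, rfl⟩
      have h1 := SetLike.GradedMul.mul_mem (altWords_le hN𝒜 _ _ hx) (hℬ𝒜 _ _ hz)
      have h2 := Finset.mem_Icc.1 hj
      have h3 := h2.2.trans (min_le_left _ _)
      have h4 := h2.2.trans (min_le_right _ _)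
      rw [show p + (q - j) = p + q - j by omega] at h1
      have := mul_mem_rightMultiples (d := d) (c := c) (n := p + q) (j := j)
        (Finset.mem_Icc.2 ⟨h2.1, by omega⟩) h1
      simpa [mul_assoc] using this
    exact h hy

/-- The last factor of the word and the new factor come from the same subalgebra; merging them
reduces to a shorter word ending in the other one. -/
theorem altWords_mul_le' (hℬmul : ∀ b p q, ℬ b p * ℬ b q ≤ ℬ b (p + q))
    (hℬ𝒜 : ∀ b n, ℬ b n ≤ 𝒜 n) (hNℬ : ∀ b n, N b n ≤ ℬ b n)
    (hN : ∀ b n, n ≠ 0 → ℬ b n ≤ N b n ⊔ rightMultiples (ℬ b) d c n)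
    (b : Bool) (p q : ℕ) (hq : q ≠ 0) :
    altWords N b p * ℬ b q ≤ (⨆ b, altWords N b (p + q)) ⊔ rightMultiples 𝒜 d c (p + q) := by
  have hN𝒜 : ∀ b n, N b n ≤ 𝒜 n := fun b n => (hNℬ b n).trans (hℬ𝒜 b n)
  rcases eq_or_ne p 0 with rfl | hp
  · rw [altWords_zero, ← altWords_zero N (!b)]
    exact altWords_mul_le hℬ𝒜 hN𝒜 hN b 0 q hq
  · rw [altWords_of_pos N b hp, Finset.sup_eq_iSup, Submodule.iSup_mul]
    refine iSup_le fun k => ?_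
    rw [Submodule.iSup_mul]
    refine iSup_le fun _ => ?_
    rw [mul_assoc]
    have h1 : N b (p - k) * ℬ b q ≤ ℬ b (p - k + q) :=
      (mul_le_mul' (hNℬ _ _) le_rfl).trans (hℬmul _ _ _)
    have h2 := altWords_mul_le (d := d) (c := c) hℬ𝒜 hN𝒜 hN b k (p - k + q) (by omega)
    rw [show (k : ℕ) + (p - k + q) = p + q by omega] at h2
    exact (mul_le_mul' le_rfl h1).trans h2

/-- A spanning statement only: words are straightened one factor at a time, and no uniqueness is
claimed or needed. -/
theorem le_altWords_sup (hℬmul : ∀ b p q, ℬ b p * ℬ b q ≤ ℬ b (p + q))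
    (hℬ𝒜 : ∀ b n, ℬ b n ≤ 𝒜 n) (hNℬ : ∀ b n, N b n ≤ ℬ b n)
    (hN : ∀ b n, n ≠ 0 → ℬ b n ≤ N b n ⊔ rightMultiples (ℬ b) d c n)
    (hc : ∀ b, ∀ j ∈ Finset.Icc 1 d, c j ∈ ℬ b j)
    (h𝒜0 : 𝒜 0 ≤ 1) (h𝒜 : ∀ n, n ≠ 0 → 𝒜 n ≤ ⨆ b, ⨆ p : Fin n, 𝒜 p * ℬ b (n - p)) (n : ℕ) :
    𝒜 n ≤ (⨆ b, altWords N b n) ⊔ rightMultiples 𝒜 d c n := by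
  -- The induction has to carry products with one further factor of arbitrary positive degree q,
  -- since absorbing c_j lowers n but raises q.
  suffices h : 𝒜 n ≤ (⨆ b, altWords N b n) ⊔ rightMultiples 𝒜 d c n ∧ ∀ b q, q ≠ 0 →
      𝒜 n * ℬ b q ≤ (⨆ b, altWords N b (n + q)) ⊔ rightMultiples 𝒜 d c (n + q) from h.1
  induction n using Nat.strong_induction_on with
  | _ n ih =>
    have h1 : 𝒜 n ≤ (⨆ b, altWords N b n) ⊔ rightMultiples 𝒜 d c n := by
      rcases eq_or_ne n 0 with rfl | hn
      · refine le_sup_of_le_left (le_iSup_of_le true ?_)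
        rw [altWords_zero]
        exact h𝒜0
      · refine (h𝒜 n hn).trans (iSup_le fun b => iSup_le fun p => ?_)
        have := (ih p p.2).2 b (n - p) (by omega)
        rwa [Nat.add_sub_cancel' p.2.le] at this
    refine ⟨h1, fun b q hq => (mul_le_mul' h1 le_rfl).trans ?_⟩
    rw [Submodule.sup_mul, Submodule.iSup_mul]
    refine sup_le (iSup_le fun b' => ?_) ?_
    · rcases eq_or_ne b' b with rfl | hb
      · exact altWords_mul_le' hℬmul hℬ𝒜 hNℬ hN b' n q hq
      · rw [Bool.eq_not.2 hb]
        exact altWords_mul_le hℬ𝒜 (fun b n => (hNℬ b n).trans (hℬ𝒜 b n)) hN b n q hq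
    · rw [Submodule.mul_le]
      intro x hx y hy
      have h : rightMultiples 𝒜 d c n ≤
          ((⨆ b, altWords N b (n + q)) ⊔ rightMultiples 𝒜 d c (n + q)).comap
            (LinearMap.mulRight F y) := by
        refine Finset.sup_le fun j hj => ?_
        rintro _ ⟨z, hz, rfl⟩
        have h2 := Finset.mem_Icc.1 hj
        have h3 := h2.2.trans (min_le_left _ _)
        have h4 := h2.2.trans (min_le_right _ _)
        -- As c_j lies in both subalgebras, c_j y is again a single factor, and the element z before
        -- it has degree n − j < n.
        have h5 := hℬmul b j q (Submodule.mul_mem_mul (hc b j (Finset.mem_Icc.2 ⟨h2.1, h3⟩)) hy)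
        have h6 := (ih (n - j) (by omega)).2 b (j + q) (by omega) (Submodule.mul_mem_mul hz h5)
        rw [show n - j + (j + q) = n + q by omega] at h6
        simpa [mul_assoc] using h6
      exact h hx

theorem finrank_le_altCount [∀ n, FiniteDimensional F (𝒜 n)]
    (hℬmul : ∀ b p q, ℬ b p * ℬ b q ≤ ℬ b (p + q))
    (hℬ𝒜 : ∀ b n, ℬ b n ≤ 𝒜 n) (hNℬ : ∀ b n, N b n ≤ ℬ b n)
    (hN : ∀ b n, n ≠ 0 → ℬ b n ≤ N b n ⊔ rightMultiples (ℬ b) d c n)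
    (hc : ∀ b, ∀ j ∈ Finset.Icc 1 d, c j ∈ ℬ b j)
    (h𝒜0 : 𝒜 0 ≤ 1) (h𝒜 : ∀ n, n ≠ 0 → 𝒜 n ≤ ⨆ b, ⨆ p : Fin n, 𝒜 p * ℬ b (n - p))
    (ν : Bool → ℕ → ℕ) (hν : ∀ b n, n ≠ 0 → Module.finrank F (N b n) ≤ ν b n) (n : ℕ) :
    Module.finrank F (𝒜 n) ≤ altCount ν true n + altCount ν false n +
      ∑ j ∈ Finset.Icc 1 (min d n), Module.finrank F (𝒜 (n - j)) := by
  have fdN : ∀ b n, FiniteDimensional F (N b n) := fun b n =>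
    Submodule.finiteDimensional_of_le ((hNℬ b n).trans (hℬ𝒜 b n))
  have hU := finrank_altWords_le N ν hν
  have fdU := fun b => (hU b n).1
  have hL : Module.finrank F (rightMultiples 𝒜 d c n) ≤
      ∑ j ∈ Finset.Icc 1 (min d n), Module.finrank F (𝒜 (n - j)) :=
    (finrank_finset_sup_le _ _).trans (Finset.sum_le_sum fun j _ => Submodule.finrank_map_le _ _)
  have fdL : FiniteDimensional F (rightMultiples 𝒜 d c n) :=
    Submodule.finiteDimensional_finset_sup _ _
  have h := le_altWords_sup hℬmul hℬ𝒜 hNℬ hN hc h𝒜0 h𝒜 n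
  rw [iSup_bool_eq] at h
  refine (Submodule.finrank_mono h).trans ((Submodule.finrank_add_le_finrank_add_finrank _ _).trans
    (add_le_add ((Submodule.finrank_add_le_finrank_add_finrank _ _).trans
      (add_le_add (hU true n).2 (hU false n).2)) hL))

end Spanning

end AlternatingWords

/-! ### The power series argument. -/

section Series

open PowerSeries

/-- The series `z + z² + ⋯ + z^d`. -/
noncomputable def truncGeom (d : ℕ) : PowerSeries ℤ :=
  PowerSeries.mk fun n => if n ∈ Finset.Icc 1 d then 1 else 0

theorem coeff_mul_truncGeom (a : ℕ → ℤ) (d n : ℕ) :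
    coeff n (PowerSeries.mk a * truncGeom d) = ∑ j ∈ Finset.Icc 1 (min d n), a (n - j) := by
  rw [PowerSeries.coeff_mul, ← Finset.Nat.sum_antidiagonal_swap,
    Finset.Nat.sum_antidiagonal_eq_sum_range_succ_mk]
  simp only [truncGeom, Prod.fst_swap, Prod.snd_swap, coeff_mk, mul_ite, mul_one, mul_zero]
  rw [← Finset.sum_filter]
  refine Finset.sum_congr ?_ fun _ _ => rfl
  ext j
  simp only [Finset.mem_filter, Finset.mem_range, Finset.mem_Icc]
  omega

/-- Cut off the last factor of a nonempty alternating word. -/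
theorem mk_altCount (ν : Bool → ℕ → ℕ) (b : Bool) :
    PowerSeries.mk (fun n => (altCount ν b n : ℤ)) = 1 +
      PowerSeries.mk (fun n => (altCount ν (!b) n : ℤ)) *
        PowerSeries.mk (fun n => if n = 0 then 0 else (ν b n : ℤ)) := by
  ext n
  rw [map_add, PowerSeries.coeff_mul, Finset.Nat.sum_antidiagonal_eq_sum_range_succ_mk,
    Finset.sum_range_succ, coeff_mk, altCount, PowerSeries.coeff_one]
  simp only [coeff_mk, Nat.sub_self, if_true, mul_zero, add_zero]
  split_ifs with hn
  · simp [hn]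
  · rw [Fin.sum_univ_eq_sum_range (fun p => altCount ν (!b) p * ν b (n - p)) n]
    push_cast
    rw [zero_add]
    refine Finset.sum_congr rfl fun p hp => ?_
    rw [if_neg (by have := Finset.mem_range.1 hp; omega)]

theorem coeff_mul_nonneg {f g : PowerSeries ℤ} (hf : ∀ n, 0 ≤ coeff n f)
    (hg : ∀ n, 0 ≤ coeff n g) (n : ℕ) : 0 ≤ coeff n (f * g) := by
  rw [PowerSeries.coeff_mul]
  exact Finset.sum_nonneg fun p _ => mul_nonneg (hf _) (hg _)

/-- Here G = u₁ + u₂ − 1 counts alternating words, the empty one once. The opposite bounds on `H`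
are compared after multiplication by G; `D'` need only be bounded above by D, so the relation space
need not be measured exactly. -/
theorem mul_eq_one_of_bounds {H D' D₁ D₂ H₁ H₂ : PowerSeries ℤ} {d : ℕ} {ν : Bool → ℕ → ℕ}
    (h₁ : H₁ * D₁ = 1) (h₂ : H₂ * D₂ = 1)
    (hν₁ : H₁ * (1 - truncGeom d) =
      1 + PowerSeries.mk (fun n => if n = 0 then 0 else (ν true n : ℤ)))
    (hν₂ : H₂ * (1 - truncGeom d) =
      1 + PowerSeries.mk (fun n => if n = 0 then 0 else (ν false n : ℤ)))
    (hH : ∀ n, 0 ≤ coeff n H)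
    (hup : ∀ n, coeff n (H * (1 - truncGeom d)) ≤ coeff n
      (PowerSeries.mk (fun n => (altCount ν true n : ℤ)) +
        PowerSeries.mk (fun n => (altCount ν false n : ℤ)) - 1))
    (hD' : ∀ n, coeff n D' ≤ coeff n (D₁ + D₂ - 1 + truncGeom d))
    (hlow : ∀ n, coeff n (1 : PowerSeries ℤ) ≤ coeff n (H * D')) : H * D' = 1 := by
  have e1 := mk_altCount ν true
  have e2 := mk_altCount ν false
  simp only [Bool.not_true, Bool.not_false] at e1 e2
  set u₁ := PowerSeries.mk (fun n => (altCount ν true n : ℤ)) with hu₁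
  set u₂ := PowerSeries.mk (fun n => (altCount ν false n : ℤ)) with hu₂
  set g₁ := PowerSeries.mk (fun n => if n = 0 then 0 else (ν true n : ℤ))
  set g₂ := PowerSeries.mk (fun n => if n = 0 then 0 else (ν false n : ℤ))
  set D := D₁ + D₂ - 1 + truncGeom d with hD
  set G := u₁ + u₂ - 1 with hG
  have hG1 : G = u₂ * (1 + g₁) := by rw [hG]; linear_combination e1
  have hG2 : G = u₁ * (1 + g₂) := by rw [hG]; linear_combination e2
  -- G factors both as u₂ (1 + g₁) and as u₁ (1 + g₂), and D_i (1 + g_i) = 1 − T.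
  have hDG : D * G = 1 - truncGeom d := by
    have a1 : D₁ * G = u₂ * (1 - truncGeom d) := by
      rw [hG1, ← hν₁]; linear_combination u₂ * (1 - truncGeom d) * h₁
    have a2 : D₂ * G = u₁ * (1 - truncGeom d) := by
      rw [hG2, ← hν₂]; linear_combination u₁ * (1 - truncGeom d) * h₂
    rw [hD]
    linear_combination a1 + a2 - (1 - truncGeom d) * hG
  have hnn : ∀ n, 0 ≤ coeff n (D - D') := fun n => by
    rw [map_sub]; linarith [hD' n]
  have hHDD := coeff_mul_nonneg hH hnn
  have hp : ∀ n, 0 ≤ coeff n (H * D - 1) := fun n => by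
    have := hHDD n
    rw [mul_sub, map_sub] at this
    rw [map_sub]
    linarith [hlow n]
  have hG0 : ∀ n, 0 ≤ coeff n G := fun n => by
    rw [hG1]
    refine coeff_mul_nonneg (fun n => by rw [hu₂, coeff_mk]; positivity) (fun n => ?_) n
    rw [map_add, PowerSeries.coeff_one, coeff_mk]
    split_ifs <;> positivity
  have hG00 : coeff 0 G = 1 := by
    rw [hG]
    simp [hu₁, hu₂, altCount_zero]
  have hzero : H * D - 1 = 0 := by
    ext n
    refine le_antisymm ?_ (hp n)
    have h1 : coeff n ((H * D - 1) * G) ≤ 0 := by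
      rw [sub_mul, mul_assoc, hDG, one_mul, map_sub]
      linarith [hup n]
    rw [PowerSeries.coeff_mul] at h1
    -- The term (n, 0) of the convolution is the nth coefficient of H D − 1, because G has constant
    -- term 1.
    have h2 := Finset.single_le_sum (s := Finset.HasAntidiagonal.antidiagonal n)
      (f := fun p : ℕ × ℕ => coeff p.1 (H * D - 1) * coeff p.2 G)
      (fun p _ => mul_nonneg (hp _) (hG0 _))
      (Finset.HasAntidiagonal.mem_antidiagonal.2 (add_zero n) : (n, 0) ∈ _)
    simp only [hG00, mul_one] at h2
    rw [map_zero]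
    linarith
  ext n
  refine le_antisymm ?_ (hlow n)
  have := hHDD n
  rw [mul_sub, map_sub, sub_eq_zero.1 hzero] at this
  linarith

end Series

/-! ### Paths, generators and nontriviality of A(Γ). -/

namespace GenLayeredGraph

section Basic

variable {V E : Type*} (Γ : GenLayeredGraph V E)

variable {Γ} in
theorem IsPath.rank_lt {v w : V} {π : List E} (h : Γ.IsPath v w π) : Γ.rank w < Γ.rank v := by
  induction h with
  | single e => exact Γ.rank_head_lt e
  | cons e _ ih => exact ih.trans (Γ.rank_head_lt e)

theorem IsUniqueMaximal.head_ne {M : V} (hM : Γ.IsUniqueMaximal M) (e : E) : Γ.head e ≠ M :=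
  fun h => (hM M).2 rfl (Γ.tail e) ⟨[e], h ▸ IsPath.single e⟩

theorem IsUniqueMinimal.tail_ne {m : V} (hm : Γ.IsUniqueMinimal m) (e : E) : Γ.tail e ≠ m :=
  fun h => (hm m).2 rfl (Γ.head e) ⟨[e], h ▸ IsPath.single e⟩

variable {Γ} in
-- Follow outgoing edges: the rank drops, and a path can get stuck only at m.
theorem IsUniqueMinimal.above {m : V} (hm : Γ.IsUniqueMinimal m) (v : V) (hv : v ≠ m) :
    Γ.Above v m := by
  induction hr : Γ.rank v using Nat.strong_induction_on generalizing v with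
  | _ r ih =>
    subst hr
    have h : ∃ w, Γ.Above v w := by
      by_contra h
      exact hv ((hm v).1 (not_exists.1 h))
    obtain ⟨w, π, hπ⟩ := h
    obtain ⟨e, rfl⟩ : ∃ e, Γ.tail e = v := by cases hπ <;> exact ⟨_, rfl⟩
    by_cases he : Γ.head e = m
    · exact ⟨[e], he ▸ IsPath.single e⟩
    · obtain ⟨π', hπ'⟩ := ih _ (Γ.rank_head_lt e) _ he rfl
      exact ⟨e :: π', IsPath.cons e hπ'⟩

/-- The generator `a_n(e)`. -/
def gen (e : E) (n : ℕ) (h : 1 ≤ n ∧ n ≤ Γ.len e) : Γ.Gen := ⟨(e, n), h⟩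

variable {Γ} in
/-- The edge of a generator. -/
def Gen.edge (g : Γ.Gen) : E := g.1.1

variable (F : Type*) [Field F]

theorem a_eq_ι_gen {e : E} {n : ℕ} (h : 1 ≤ n ∧ n ≤ Γ.len e) :
    Γ.a F e n = FreeAlgebra.ι F (Γ.gen e n h) := by
  rw [a, dif_pos h]; rfl

theorem a_edge_genDeg (g : Γ.Gen) : Γ.a F g.edge (Γ.genDeg g) = FreeAlgebra.ι F g :=
  a_eq_ι_gen Γ F g.2

theorem a_zero (e : E) : Γ.a F e 0 = 1 := by
  simp [a]

theorem a_eq_zero {e : E} {n : ℕ} (h : Γ.len e < n) : Γ.a F e n = 0 := by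
  rw [a, dif_neg (by omega), if_neg (by omega)]

theorem a_cases (e : E) (n : ℕ) :
    (∃ h, Γ.a F e n = FreeAlgebra.ι F (Γ.gen e n h)) ∨ (n = 0 ∧ Γ.a F e n = 1) ∨
      (Γ.len e < n ∧ Γ.a F e n = 0) := by
  rcases Nat.eq_zero_or_pos n with rfl | hn
  · exact .inr (.inl ⟨rfl, a_zero Γ F e⟩)
  · rcases Nat.lt_or_ge (Γ.len e) n with h | h
    · exact .inr (.inr ⟨h, a_eq_zero Γ F h⟩)
    · exact .inl ⟨⟨hn, h⟩, a_eq_ι_gen Γ F ⟨hn, h⟩⟩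

instance : SetLike.GradedMonoid (Γ.algDegree F) :=
  gradedMonoid_map (freeDegree F Γ.genDeg) (RingQuot.mkAlgHom F (Γ.Rel F))

theorem coeff_edgePoly (e : E) (n : ℕ) : (Γ.edgePoly F e).coeff n = (-1) ^ n * Γ.a F e n := by
  simp only [edgePoly, coeff_add, coeff_one, finsetSum_coeff, coeff_C_mul, coeff_X_pow, mul_ite,
    mul_one, mul_zero, Finset.sum_ite_eq, Finset.mem_Icc]
  rcases Nat.eq_zero_or_pos n with rfl | hn
  · simp [a]
  · rw [if_neg hn.ne', zero_add]
    split_ifs with h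
    · rfl
    · rw [a, dif_neg h, if_neg hn.ne', mul_zero]

theorem a_mem_freeDegree (e : E) (n : ℕ) : Γ.a F e n ∈ freeDegree F Γ.genDeg n := by
  rcases Γ.a_cases F e n with ⟨h, ha⟩ | ⟨rfl, ha⟩ | ⟨h, ha⟩ <;> rw [ha]
  · exact ι_mem_freeDegree Γ.genDeg (Γ.gen e n h)
  · exact SetLike.GradedOne.one_mem
  · exact zero_mem _

theorem neg_one_pow_mul_mem {A : Type*} [Ring A] [Algebra F A] {p : Submodule F A} {x : A}
    (hx : x ∈ p) (n : ℕ) : (-1) ^ n * x ∈ p := by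
  rcases neg_one_pow_eq_or A n with h | h <;> rw [h]
  · simpa using hx
  · simpa using hx

theorem pathCoeff_mem_freeDegree (π : List E) (n : ℕ) :
    Γ.pathCoeff F π n ∈ freeDegree F Γ.genDeg n := by
  refine neg_one_pow_mul_mem F ?_ n
  induction π generalizing n with
  | nil =>
    rw [pathPoly, List.map_nil, List.prod_nil, coeff_one]
    split_ifs with h
    · exact h ▸ SetLike.GradedOne.one_mem
    · exact zero_mem _
  | cons e π ih =>
    rw [pathPoly, List.map_cons, List.prod_cons, coeff_mul]
    refine Submodule.sum_mem _ fun p hp => ?_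
    rw [← Finset.HasAntidiagonal.mem_antidiagonal.1 hp]
    refine SetLike.GradedMul.mul_mem ?_ (ih _)
    rw [coeff_edgePoly]
    exact neg_one_pow_mul_mem F (Γ.a_mem_freeDegree F e _) _

/-- Sending every generator to 0 sends every P_π to 1, so this augmentation respects the relations.
-/
instance : Nontrivial (Γ.Alg F) := by
  have hf : ∀ π : List E, Polynomial.mapRingHom
      (FreeAlgebra.lift F fun _ : Γ.Gen => (0 : F)).toRingHom (Γ.pathPoly F π) = 1 := fun π => by
    induction π with
    | nil => simp [pathPoly]
    | cons e π ih =>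
      rw [pathPoly, List.map_cons, List.prod_cons, map_mul, ← pathPoly, ih, mul_one]
      ext n
      rw [coe_mapRingHom, coeff_map, coeff_edgePoly, coeff_one]
      rcases Γ.a_cases F e n with ⟨h, ha⟩ | ⟨rfl, ha⟩ | ⟨h, ha⟩ <;> rw [ha]
      · rw [if_neg (by omega)]
        simp
      · simp
      · rw [if_neg (by omega)]
        simp
  let ε : Γ.Alg F →ₐ[F] F := RingQuot.liftAlgHom F ⟨FreeAlgebra.lift F fun _ => 0, by
    rintro _ _ ⟨_, _, _, _⟩
    rename_i v w π₁ π₂ h₁ h₂ j _ _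
    have h : ∀ π, FreeAlgebra.lift F (fun _ : Γ.Gen => (0 : F)) (Γ.pathCoeff F π j) =
        (-1) ^ j * (1 : F[X]).coeff j := fun π => by
      rw [← hf π, coe_mapRingHom, coeff_map, pathCoeff, map_mul]
      simp
    rw [h, h]⟩
  exact ε.toRingHom.domain_nontrivial

end Basic

/-! ### Left independence of the coefficients of a maximal path. -/

section Independence

open Matrix

/-- The strictly upper triangular matrix with entry `t ^ (j - i)` in the positions allowed for
paths with tail of rank `s` and head of rank `r`; row `0` is nonzero only if `p` holds. -/
noncomputable def shiftMatrix (S : Type*) [Ring S] (d s r : ℕ) (p : Prop) [Decidable p] :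
    Matrix (Fin (d + 1)) (Fin (d + 1)) S[X] :=
  Matrix.of fun i j => if i < j ∧ d ≤ s + i ∧ (i = 0 → p) ∧ j + r ≤ d then X ^ (j - i : ℕ) else 0

/-- The factors live on the index intervals [d − s, d − u] and [d − u, d − r], which meet only at d
− u. Passing through this index, the product supplies exactly the pairs (i, j) with i < d − u < j.
-/
theorem shiftMatrix_add_mul {S : Type*} [Ring S] {d s u r : ℕ} {p : Prop} [Decidable p]
    (hsu : u < s) (hur : r < u) (hp : p → s = d) :
    shiftMatrix S d s u p + shiftMatrix S d u r False +
      shiftMatrix S d s u p * shiftMatrix S d u r False = shiftMatrix S d s r p := by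
  have hmul : shiftMatrix S d s u p * shiftMatrix S d u r False = Matrix.of fun i j : Fin (d + 1) =>
      if (i : ℕ) + u < d ∧ d < j + u ∧ d ≤ s + i ∧ (i = 0 → p) ∧ j + r ≤ d
        then X ^ (j - i : ℕ) else 0 := by
    ext1 i j
    rw [Matrix.mul_apply, Matrix.of_apply]
    split_ifs with h
    · obtain ⟨h1, h2, h3, h4, h5⟩ := h
      rw [Finset.sum_eq_single (⟨d - u, by omega⟩ : Fin (d + 1))]
      · simp only [shiftMatrix, Matrix.of_apply, Fin.lt_def]
        rw [if_pos ⟨by omega, h3, h4, by omega⟩, if_pos ⟨by omega, by omega, fun h => by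
          have := congrArg Fin.val h; simp at this; omega, h5⟩, ← pow_add]
        congr 1; omega
      · intro k _ hk
        simp only [shiftMatrix, Matrix.of_apply, Fin.lt_def]
        have : (k : ℕ) ≠ d - u := fun h => hk (Fin.ext h)
        split_ifs <;> first | (exfalso; omega) | simp
      · simp
    · refine Finset.sum_eq_zero fun k _ => ?_
      simp only [shiftMatrix, Matrix.of_apply, Fin.lt_def]
      split_ifs with h1 h2
      · exact (h ⟨by omega, by omega, h1.2.1, h1.2.2.1, h2.2.2.2⟩).elim
      all_goals simp
  rw [hmul]
  ext1 i j
  have h0 : i = 0 ↔ (i : ℕ) = 0 := Fin.ext_iff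
  by_cases hp' : p
  · have := hp hp'
    simp only [shiftMatrix, Matrix.add_apply, Matrix.of_apply, Fin.lt_def, hp', h0, implies_true, true_and, imp_false]
    split_ifs <;> first | (exfalso; omega) | simp
  · simp only [shiftMatrix, Matrix.add_apply, Matrix.of_apply, Fin.lt_def, hp', h0, imp_false]
    split_ifs <;> first | (exfalso; omega) | simp

/-- `shiftMatrix` with diagonal entries `1`, except for `f` in position `(0, 0)`. -/
noncomputable def twistedMatrix {S : Type*} [Ring S] (d s r : ℕ) (p : Prop) [Decidable p]
    (f : S[X]) : Matrix (Fin (d + 1)) (Fin (d + 1)) S[X] :=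
  1 + shiftMatrix S d s r p + Matrix.single 0 0 (f - 1)

/-- The corner entry does not interact with the shifts: a shift has zero column 0, and the second
one, having `False` as its condition, also has zero row 0. -/
theorem twistedMatrix_mul {S : Type*} [Ring S] {d s u r : ℕ} {p : Prop} [Decidable p]
    (hsu : u < s) (hur : r < u) (hp : p → s = d) (f g : S[X]) :
    twistedMatrix d s u p f * twistedMatrix d u r False g = twistedMatrix d s r p (f * g) := by
  have h1 : shiftMatrix S d s u p * Matrix.single 0 0 (g - 1) = 0 := by
    ext1 i j
    rw [Matrix.mul_apply]
    refine Finset.sum_eq_zero fun k _ => ?_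
    rcases eq_or_ne k 0 with rfl | hk
    · simp [shiftMatrix]
    · rw [Matrix.single_apply_of_row_ne hk.symm, mul_zero]
  have h2 : Matrix.single 0 0 (f - 1) * shiftMatrix S d u r False = 0 := by
    ext1 i j
    rw [Matrix.mul_apply]
    refine Finset.sum_eq_zero fun k _ => ?_
    rcases eq_or_ne k 0 with rfl | hk
    · simp [shiftMatrix]
    · rw [Matrix.single_apply_of_col_ne _ _ hk.symm, zero_mul]
  have h3 : (Matrix.single 0 0 (f * g - 1) : Matrix (Fin (d + 1)) (Fin (d + 1)) S[X]) =
      Matrix.single 0 0 (f - 1) + Matrix.single 0 0 (g - 1) +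
        Matrix.single 0 0 (f - 1) * Matrix.single 0 0 (g - 1) := by
    rw [Matrix.single_mul_single_same, ← Matrix.single_add, ← Matrix.single_add]
    congr 1
    noncomm_ring
  rw [twistedMatrix, twistedMatrix, twistedMatrix, h3, ← shiftMatrix_add_mul hsu hur hp]
  simp only [add_mul, mul_add, one_mul, mul_one, h1, h2]
  abel

variable {V E : Type*} (Γ : GenLayeredGraph V E) (F : Type*) [Field F]

/-- The image of `P_π` in `A(Γ)[t]`. -/
noncomputable def algPoly (π : List E) : (Γ.Alg F)[X] :=
  Polynomial.mapRingHom (RingQuot.mkAlgHom F (Γ.Rel F)).toRingHom (Γ.pathPoly F π)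

theorem coeff_algPoly (π : List E) (n : ℕ) : (Γ.algPoly F π).coeff n =
    RingQuot.mkAlgHom F (Γ.Rel F) ((Γ.pathPoly F π).coeff n) := by
  rw [algPoly, coe_mapRingHom, coeff_map]
  rfl

open Classical in
/-- The action of the generators of `A(Γ)` by matrices over `A(Γ)`. -/
noncomputable def twistedHom (M : V) (d : ℕ) :
    FreeAlgebra F Γ.Gen →ₐ[F] Matrix (Fin (d + 1)) (Fin (d + 1)) (Γ.Alg F) :=
  FreeAlgebra.lift F fun g => Matrix.of fun i j => (-1) ^ Γ.genDeg g *
    (twistedMatrix d (Γ.rank (Γ.tail g.edge)) (Γ.rank (Γ.head g.edge)) (Γ.tail g.edge = M)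
      (Γ.algPoly F [g.edge]) i j).coeff (Γ.genDeg g)

theorem neg_one_pow_mul_self {S : Type*} [Ring S] (n : ℕ) (x : S) :
    (-1) ^ n * ((-1) ^ n * x) = x := by
  rcases neg_one_pow_eq_or S n with h | h <;> simp [h]

theorem neg_one_pow_mul_apply {S ι : Type*} [Ring S] [Fintype ι] [DecidableEq ι]
    (T : Matrix ι ι S) (n : ℕ) (i j : ι) : ((-1) ^ n * T) i j = (-1) ^ n * T i j := by
  rcases Nat.even_or_odd n with h | h <;> simp [h.neg_one_pow]

open Classical in
-- The definition prescribes this for 1 ≤ n ≤ l(e). For n = 0 both sides give the identity; for n >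
-- l(e) both vanish, as a nonzero entry t^(j − i) of the shift has j − i ≤ l(e).
theorem twistedHom_coeff_edge (M : V) (d : ℕ) (e : E) (n : ℕ) (i j : Fin (d + 1)) :
    Γ.twistedHom F M d ((Γ.pathPoly F [e]).coeff n) i j =
      (twistedMatrix d (Γ.rank (Γ.tail e)) (Γ.rank (Γ.head e)) (Γ.tail e = M)
        (Γ.algPoly F [e]) i j).coeff n := by
  have he : (Γ.pathPoly F [e]).coeff n = (-1) ^ n * Γ.a F e n := by
    rw [← coeff_edgePoly]; simp [pathPoly]
  rw [he]
  rcases Γ.a_cases F e n with ⟨h, ha⟩ | ⟨rfl, ha⟩ | ⟨hn, ha⟩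
  · rw [ha, map_mul, map_pow, map_neg, map_one, neg_one_pow_mul_apply, twistedHom,
      FreeAlgebra.lift_ι_apply, Matrix.of_apply]
    exact neg_one_pow_mul_self n _
  · rw [ha]
    simp only [pow_zero, mul_one, map_one]
    have h00 : (Γ.algPoly F [e]).coeff 0 = 1 := by
      rw [coeff_algPoly, he, ha]
      simp
    have hs : (shiftMatrix (Γ.Alg F) d (Γ.rank (Γ.tail e)) (Γ.rank (Γ.head e))
        (Γ.tail e = M) i j).coeff 0 = 0 := by
      rw [shiftMatrix, Matrix.of_apply]
      split_ifs with h
      · rw [coeff_X_pow, if_neg]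
        have := Fin.lt_def.1 h.1
        omega
      · simp
    rw [twistedMatrix, Matrix.add_apply, Matrix.add_apply, coeff_add, coeff_add, hs,
      Matrix.single_apply, Matrix.one_apply, Matrix.one_apply]
    split_ifs <;> simp [h00]
  · rw [ha]
    have h00 : (Γ.algPoly F [e]).coeff n = 0 := by
      rw [coeff_algPoly, he, ha]
      simp
    have hs : (shiftMatrix (Γ.Alg F) d (Γ.rank (Γ.tail e)) (Γ.rank (Γ.head e))
        (Γ.tail e = M) i j).coeff n = 0 := by
      rw [shiftMatrix, Matrix.of_apply]
      split_ifs with h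
      · rw [coeff_X_pow, if_neg]
        rw [len] at hn
        omega
      · simp
    rw [twistedMatrix, Matrix.add_apply, Matrix.add_apply, coeff_add, coeff_add, hs,
      Matrix.single_apply, Matrix.one_apply]
    split_ifs <;> simp [h00, coeff_one, (show n ≠ 0 by omega)]

open Classical in
theorem twistedHom_coeff_path {M : V} {d : ℕ} (hM : ∀ e, Γ.head e ≠ M) (hd : Γ.rank M = d)
    {v w : V} {π : List E} (h : Γ.IsPath v w π) (n : ℕ) (i j : Fin (d + 1)) :
    Γ.twistedHom F M d ((Γ.pathPoly F π).coeff n) i j =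
      (twistedMatrix d (Γ.rank v) (Γ.rank w) (v = M) (Γ.algPoly F π) i j).coeff n := by
  induction h generalizing n i j with
  | single e => exact twistedHom_coeff_edge Γ F M d e n i j
  | @cons e w π h ih =>
    have h1 : Γ.pathPoly F (e :: π) = Γ.pathPoly F [e] * Γ.pathPoly F π := by simp [pathPoly]
    have h2 : Γ.algPoly F (e :: π) = Γ.algPoly F [e] * Γ.algPoly F π := by
      rw [algPoly, h1, map_mul]; rfl
    have h3 := twistedMatrix_mul (Γ.rank_head_lt e) h.rank_lt
      (p := Γ.tail e = M) (fun h => by rw [h, hd]) (Γ.algPoly F [e]) (Γ.algPoly F π)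
    -- Only the first edge of a path can start at M, so the tail of the path has condition `False`.
    simp only [hM e] at ih
    rw [h1, h2, ← h3, coeff_mul, map_sum, Matrix.sum_apply, Matrix.mul_apply, finsetSum_coeff]
    simp only [map_mul, Matrix.mul_apply, coeff_mul]
    rw [Finset.sum_comm]
    refine Finset.sum_congr rfl fun k _ => Finset.sum_congr rfl fun p _ => ?_
    rw [twistedHom_coeff_edge, ih]

/-- The matrix of a path depends only on its ends and on the image of P_π in A(Γ), so parallel paths
act alike. -/
theorem twistedHom_rel {M : V} {d : ℕ} (hM : ∀ e, Γ.head e ≠ M) (hd : Γ.rank M = d)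
    ⦃x y : FreeAlgebra F Γ.Gen⦄ (hxy : Γ.Rel F x y) :
    Γ.twistedHom F M d x = Γ.twistedHom F M d y := by
  classical
  have hq := RingQuot.mkAlgHom_rel F hxy
  obtain ⟨h₁, h₂, hj, hj'⟩ := hxy
  rename_i v w π₁ π₂ j
  have hc : (Γ.algPoly F π₁).coeff j = (Γ.algPoly F π₂).coeff j := by
    rw [pathCoeff, pathCoeff, map_mul, map_mul] at hq
    have := congrArg (fun z => (-1) ^ j * z) hq
    simp only [map_pow, map_neg, map_one, neg_one_pow_mul_self] at this
    rw [coeff_algPoly, coeff_algPoly, this]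
  ext1 i k
  simp only [pathCoeff, map_mul, map_pow, map_neg, map_one, neg_one_pow_mul_apply]
  rw [twistedHom_coeff_path Γ F hM hd h₁, twistedHom_coeff_path Γ F hM hd h₂]
  simp only [twistedMatrix, Matrix.add_apply, Matrix.single_apply, coeff_add]
  split_ifs <;> simp [hc]

/-- Column 0 is zero off the corner, so the corner entry is multiplicative and recovers the element
acting. -/
theorem twistedHom_col_zero (M : V) (d : ℕ) (x : FreeAlgebra F Γ.Gen) (i : Fin (d + 1)) :
    Γ.twistedHom F M d x i 0 = if i = 0 then RingQuot.mkAlgHom F (Γ.Rel F) x else 0 := by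
  classical
  induction x using FreeAlgebra.induction generalizing i with
  | grade0 r =>
    rw [AlgHom.commutes, AlgHom.commutes, Matrix.algebraMap_matrix_apply]
  | grade1 g =>
    have h1 : (Γ.pathPoly F [g.edge]).coeff (Γ.genDeg g) =
        (-1) ^ Γ.genDeg g * FreeAlgebra.ι F g := by
      rw [← a_edge_genDeg, ← coeff_edgePoly]; simp [pathPoly]
    rw [twistedHom, FreeAlgebra.lift_ι_apply, Matrix.of_apply, twistedMatrix, Matrix.add_apply,
      Matrix.add_apply, Matrix.single_apply, Matrix.one_apply]
    by_cases hi : i = 0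
    · simp [hi, shiftMatrix, coeff_algPoly, h1, neg_one_pow_mul_self]
    · simp [hi, Ne.symm hi, shiftMatrix]
  | add f g hf hg =>
    rw [map_add, Matrix.add_apply, hf, hg, map_add]
    split_ifs <;> simp
  | mul f g hf hg =>
    rw [map_mul, Matrix.mul_apply, Finset.sum_eq_single 0]
    · rw [hf, hg, map_mul, if_pos rfl]
      split_ifs <;> simp
    · intro k _ hk
      rw [hg, if_neg hk, mul_zero]
    · simp

/-- The coefficients of `P_π`, where `π` leads from the maximal vertex to a vertex of rank `0`,
are left linearly independent in `A(Γ)`. -/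
theorem eq_zero_of_sum_mul_pathCoeff_eq_zero {M m : V} {d : ℕ} (hM : ∀ e, Γ.head e ≠ M)
    (hd : Γ.rank M = d) (hm : Γ.rank m = 0) {π : List E} (hπ : Γ.IsPath M m π)
    (x : ℕ → Γ.Alg F)
    (hx : ∑ j ∈ Finset.Icc 1 d, x j * RingQuot.mkAlgHom F (Γ.Rel F) (Γ.pathCoeff F π j) = 0)
    {n : ℕ} (hn : n ∈ Finset.Icc 1 d) : x n = 0 := by
  classical
  let Φ : Γ.Alg F →ₐ[F] Matrix (Fin (d + 1)) (Fin (d + 1)) (Γ.Alg F) :=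
    RingQuot.liftAlgHom F ⟨Γ.twistedHom F M d, Γ.twistedHom_rel F hM hd⟩
  have hΦ : ∀ y, Φ (RingQuot.mkAlgHom F (Γ.Rel F) y) = Γ.twistedHom F M d y := fun y =>
    RingQuot.liftAlgHom_mkAlgHom_apply F _ _ _
  have hΦ0 : ∀ z, Φ z 0 0 = z := fun z => by
    obtain ⟨y, rfl⟩ := RingQuot.mkAlgHom_surjective F (Γ.Rel F) z
    rw [hΦ, twistedHom_col_zero, if_pos rfl]
  -- From rank d to rank 0 the shift fills the whole strict upper triangle, so outside column 0 the
  -- jth coefficient acts as the jth superdiagonal, up to sign.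
  have hc : ∀ j ≠ 0, ∀ i k : Fin (d + 1), k ≠ 0 →
      Φ (RingQuot.mkAlgHom F (Γ.Rel F) (Γ.pathCoeff F π j)) i k =
        (-1) ^ j * if (k : ℕ) = i + j then 1 else 0 := fun j hj i k hk => by
    rw [hΦ, pathCoeff, map_mul, map_pow, map_neg, map_one, neg_one_pow_mul_apply,
      twistedHom_coeff_path Γ F hM hd hπ]
    congr 1
    rw [twistedMatrix, Matrix.add_apply, Matrix.add_apply,
      Matrix.single_apply_of_col_ne _ _ hk.symm, Matrix.one_apply, shiftMatrix, Matrix.of_apply,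
      coeff_add, coeff_add, hd, hm]
    have h1 : ((if i = k then 1 else 0 : (Γ.Alg F)[X])).coeff j = 0 := by
      split_ifs <;> simp [coeff_one, hj]
    rw [h1, coeff_zero, zero_add, add_zero]
    simp only [Fin.lt_def, implies_true, true_and, le_add_iff_nonneg_right, zero_le, add_zero]
    have := k.2
    by_cases h : (k : ℕ) = i + j
    · rw [if_pos ⟨by omega, by omega⟩, coeff_X_pow, if_pos (by omega), if_pos h]
    · rw [if_neg h]
      split_ifs with h2
      · rw [coeff_X_pow, if_neg (by omega)]
      · simp
  induction n using Nat.strong_induction_on with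
  | _ n ih =>
    have hn' := Finset.mem_Icc.1 hn
    let k : Fin (d + 1) := ⟨n, by omega⟩
    have hk : k ≠ 0 := fun h => by have := congrArg Fin.val h; simp [k] at this; omega
    -- In the entry (0, n) the terms j < n vanish by induction, those with j > n do not reach column
    -- n, and j = n contributes ± x_n.
    have h := congrFun (congrFun (congrArg Φ hx) 0) k
    rw [map_sum, Matrix.sum_apply, Finset.sum_eq_single_of_mem n hn] at h
    · rw [map_mul, Matrix.mul_apply, Finset.sum_eq_single 0] at h
      · rw [hΦ0, hc n (by omega) _ _ hk, map_zero] at h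
        rcases neg_one_pow_eq_or (Γ.Alg F) n with h' | h' <;> simpa [k, h'] using h
      · intro i _ hi
        rw [hc n (by omega) _ _ hk, if_neg, mul_zero, mul_zero]
        intro h'
        exact hi (Fin.ext (by simp [k] at h'; simpa using h'))
      · simp
    · intro j hj hjn
      have hj' := Finset.mem_Icc.1 hj
      rcases lt_or_gt_of_ne hjn with hlt | hgt
      · rw [ih j hlt hj, zero_mul, map_zero, Matrix.zero_apply]
      · rw [map_mul, Matrix.mul_apply]
        refine Finset.sum_eq_zero fun i _ => ?_
        rw [hc j (by omega) _ _ hk, if_neg, mul_zero, mul_zero]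
        simp only [k]
        omega

end Independence

end GenLayeredGraph

/-! ### Complements of the left ideal generated by the c_j. -/

section Amalgam

variable {F : Type*} [Field F]

theorem exists_comp_eq_of_surjective {T A Q : Type*} [Ring T] [Algebra F T] [Ring A] [Algebra F A]
    [Ring Q] [Algebra F Q] {φ : T →ₐ[F] A} (hφ : Function.Surjective φ) (g : T →ₐ[F] Q)
    (h : ∀ x, φ x = 0 → g x = 0) : ∃ f : A →ₐ[F] Q, ∀ x, f (φ x) = g x := by
  let f : A →+* Q := φ.toRingHom.liftOfSurjective hφ ⟨g.toRingHom, fun x hx => h x hx⟩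
  have hf : ∀ x, f (φ x) = g x := fun x =>
    RingHom.liftOfRightInverse_comp_apply φ.toRingHom _ _ ⟨g.toRingHom, fun x hx => h x hx⟩ x
  refine ⟨{ f with commutes' := fun r => ?_ }, hf⟩
  have := hf (algebraMap F T r)
  rwa [AlgHom.commutes, AlgHom.commutes] at this

section Complement

variable {A : Type*} [Ring A] [Algebra F A] {𝒜 : ℕ → Submodule F A} {d : ℕ} {c : ℕ → A}

/-- Independence makes (x_j) ↦ ∑ x_j c_j injective. -/
theorem finrank_rightMultiples [∀ n, FiniteDimensional F (𝒜 n)]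
    (hind : ∀ x : ℕ → A, ∑ j ∈ Finset.Icc 1 d, x j * c j = 0 → ∀ j ∈ Finset.Icc 1 d, x j = 0)
    (n : ℕ) : Module.finrank F (rightMultiples 𝒜 d c n) =
      ∑ j ∈ Finset.Icc 1 (min d n), Module.finrank F (𝒜 (n - j)) := by
  classical
  set s := Finset.Icc 1 (min d n) with hs
  let S : ((j : s) → 𝒜 (n - j)) →ₗ[F] A := ∑ j : s, LinearMap.mulRight F (c j) ∘ₗ
    (𝒜 (n - j)).subtype ∘ₗ LinearMap.proj j
  have hS : ∀ u, S u = ∑ j : s, (u j : A) * c j := fun u => by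
    simp [S]
  have hinj : Function.Injective S := by
    rw [← LinearMap.ker_eq_bot, LinearMap.ker_eq_bot']
    intro u hu
    let x : ℕ → A := fun j => if h : j ∈ s then u ⟨j, h⟩ else 0
    have hx : ∑ j ∈ Finset.Icc 1 d, x j * c j = 0 := by
      have hsub : s ⊆ Finset.Icc 1 d := Finset.Icc_subset_Icc_right (min_le_left _ _)
      rw [← Finset.sum_subset hsub fun j _ hj => by simp [x, hj], ← hu, hS,
        ← Finset.sum_coe_sort s fun j => x j * c j]
      exact Finset.sum_congr rfl fun j _ => by simp [x]
    ext ⟨j, hj⟩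
    have := hind x hx j (Finset.Icc_subset_Icc_right (min_le_left _ _) hj)
    simpa [x, hj] using this
  have hrange : LinearMap.range S = rightMultiples 𝒜 d c n := by
    apply le_antisymm
    · rintro _ ⟨u, rfl⟩
      rw [hS]
      exact Submodule.sum_mem _ fun j _ => mul_mem_rightMultiples j.2 (u j).2
    · refine Finset.sup_le fun j hj => ?_
      rintro _ ⟨z, hz, rfl⟩
      refine ⟨Pi.single ⟨j, hj⟩ ⟨z, hz⟩, ?_⟩
      rw [hS, Finset.sum_eq_single ⟨j, hj⟩]
      · simp
      · intro k _ hk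
        rw [Pi.single_eq_of_ne hk]
        simp
      · simp
  rw [← hrange, LinearMap.finrank_range_of_inj hinj, Module.finrank_pi_fintype,
    Finset.sum_coe_sort s fun j => Module.finrank F (𝒜 (n - j))]

/-- As ∑ A c_j is free on the c_j, its series is H T, which leaves H (1 − T) for a graded
complement. -/
theorem exists_complement_rightMultiples [SetLike.GradedMonoid 𝒜]
    [∀ n, FiniteDimensional F (𝒜 n)] (hc : ∀ j ∈ Finset.Icc 1 d, c j ∈ 𝒜 j)
    (hind : ∀ x : ℕ → A, ∑ j ∈ Finset.Icc 1 d, x j * c j = 0 → ∀ j ∈ Finset.Icc 1 d, x j = 0)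
    {D : PowerSeries ℤ} (hD : gradedDim 𝒜 * D = 1) :
    ∃ N : ℕ → Submodule F A, (∀ n, N n ≤ 𝒜 n) ∧ (∀ n, 𝒜 n ≤ N n ⊔ rightMultiples 𝒜 d c n) ∧
      gradedDim 𝒜 * (1 - truncGeom d) =
        1 + PowerSeries.mk fun n => if n = 0 then 0 else (Module.finrank F (N n) : ℤ) := by
  have hL : ∀ n, rightMultiples 𝒜 d c n ≤ 𝒜 n := fun n => by
    refine Finset.sup_le fun j hj => ?_
    rintro _ ⟨z, hz, rfl⟩
    have hj' := Finset.mem_Icc.1 hj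
    have := SetLike.GradedMul.mul_mem hz (hc j (Finset.mem_Icc.2 ⟨hj'.1, by omega⟩))
    rwa [Nat.sub_add_cancel (by omega)] at this
  choose C hC using fun n => Submodule.exists_isCompl (rightMultiples 𝒜 d c n)
  have hsup : ∀ n, rightMultiples 𝒜 d c n ⊔ C n ⊓ 𝒜 n = 𝒜 n := fun n => by
    rw [← sup_inf_assoc_of_le _ (hL n), (hC n).sup_eq_top, top_inf_eq]
  refine ⟨fun n => C n ⊓ 𝒜 n, fun n => inf_le_right, fun n => ?_, ?_⟩
  · rw [sup_comm, hsup]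
  · have hdim : ∀ n, Module.finrank F (𝒜 n) = Module.finrank F ↥(C n ⊓ 𝒜 n) +
        ∑ j ∈ Finset.Icc 1 (min d n), Module.finrank F (𝒜 (n - j)) := fun n => by
      have fdL : FiniteDimensional F (rightMultiples 𝒜 d c n) :=
        Submodule.finiteDimensional_of_le (hL n)
      have h := Submodule.finrank_sup_add_finrank_inf_eq (rightMultiples 𝒜 d c n) (C n ⊓ 𝒜 n)
      rw [hsup, ((hC n).disjoint.mono_right inf_le_left).eq_bot, finrank_bot,
        finrank_rightMultiples hind] at h
      omega
    -- The constant terms of H and D are integers with product 1, and a dimension is nonnegative.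
    have h0 : (Module.finrank F (𝒜 0) : ℤ) = 1 := by
      have h := congrArg (PowerSeries.coeff 0) hD
      rw [PowerSeries.coeff_mul] at h
      simp only [Finset.Nat.antidiagonal_zero, Finset.sum_singleton, PowerSeries.coeff_zero_one,
        gradedDim, PowerSeries.coeff_mk] at h
      rcases Int.eq_one_or_neg_one_of_mul_eq_one h with h | h
      · exact h
      · omega
    ext n
    have e : gradedDim 𝒜 = PowerSeries.mk fun k => (Module.finrank F (𝒜 k) : ℤ) := rfl
    rw [mul_sub, mul_one, map_sub, map_add, e, coeff_mul_truncGeom, PowerSeries.coeff_mk,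
      PowerSeries.coeff_mk, PowerSeries.coeff_one]
    split_ifs with hn
    · subst hn
      simp [h0]
    · have := hdim n
      rw [this]
      push_cast
      ring

end Complement

section Homogeneous

variable {X : Type*} {deg : X → ℕ}

theorem iSup_inf_freeDegree {S : ℕ → Submodule F (FreeAlgebra F X)}
    (hS : ∀ n, S n ≤ freeDegree F deg n) (n : ℕ) : (⨆ n, S n) ⊓ freeDegree F deg n = S n := by
  refine le_antisymm ?_ (le_inf (le_iSup S n) (hS n))
  rintro x ⟨hx, hxn⟩
  have h : (degreeHom F deg x).coeff n ∈ S n := by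
    clear hxn
    induction hx using Submodule.iSup_induction' with
    | mem i x hx =>
      rw [degreeHom_of_mem (hS i hx), coeff_monomial]
      split_ifs with h
      · exact h ▸ hx
      · exact zero_mem _
    | zero => simp
    | add x y _ _ hx hy => simpa using add_mem hx hy
  rwa [degreeHom_of_mem hxn, coeff_monomial, if_pos rfl] at h

end Homogeneous

end Amalgam

/-! ### Amalgams of complete intersections. -/

section Amalgam

universe u

variable {F : Type u} [Field F]

theorem ncard_sum_elim {X₁ X₂ : Type} {deg₁ : X₁ → ℕ} {deg₂ : X₂ → ℕ} {n : ℕ}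
    (h₁ : {x | deg₁ x = n}.Finite) (h₂ : {x | deg₂ x = n}.Finite) :
    {x | Sum.elim deg₁ deg₂ x = n}.Finite ∧
      {x | Sum.elim deg₁ deg₂ x = n}.ncard =
        {x | deg₁ x = n}.ncard + {x | deg₂ x = n}.ncard := by
  have h : {x | Sum.elim deg₁ deg₂ x = n} =
      Sum.inl '' {x | deg₁ x = n} ∪ Sum.inr '' {x | deg₂ x = n} := by
    ext (x | x) <;> simp
  rw [h]
  refine ⟨(h₁.image _).union (h₂.image _), ?_⟩
  rw [Set.ncard_union_eq _ (h₁.image _) (h₂.image _),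
    Set.ncard_image_of_injective _ Sum.inl_injective,
    Set.ncard_image_of_injective _ Sum.inr_injective]
  rw [Set.disjoint_left]
  rintro _ ⟨x, _, rfl⟩ ⟨y, _, hy⟩
  cases hy

theorem finrank_span_ite_singleton_le {M : Type*} [AddCommGroup M] [Module F M] (p : Prop)
    [Decidable p] (x : M) :
    Module.finrank F (Submodule.span F (if p then {x} else ∅ : Set M)) ≤ if p then 1 else 0 := by
  by_cases h : p
  · rw [if_pos h, if_pos h]
    exact (finrank_span_le_card ({x} : Set M)).trans (by simp)
  · rw [if_neg h, if_neg h, Submodule.span_empty, finrank_bot]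

instance finiteDimensional_span_ite {M : Type*} [AddCommGroup M] [Module F M] (p : Prop)
    [Decidable p] (x : M) :
    FiniteDimensional F (Submodule.span F (if p then {x} else ∅ : Set M)) := by
  by_cases h : p
  · rw [if_pos h]; infer_instance
  · rw [if_neg h, Submodule.span_empty]; infer_instance

theorem finrank_amalgam_le {A₁ A₂ A : Type*} [Ring A₁] [Algebra F A₁] [Ring A₂]
    [Algebra F A₂] [Ring A] [Algebra F A]
    {𝒜₁ : ℕ → Submodule F A₁} {𝒜₂ : ℕ → Submodule F A₂} {𝒜 : ℕ → Submodule F A}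
    [SetLike.GradedMonoid 𝒜₁] [SetLike.GradedMonoid 𝒜₂] [SetLike.GradedMonoid 𝒜]
    [∀ n, FiniteDimensional F (𝒜 n)]
    (j₁ : A₁ →ₐ[F] A) (j₂ : A₂ →ₐ[F] A)
    (hj₁ : ∀ n, (𝒜₁ n).map j₁.toLinearMap ≤ 𝒜 n) (hj₂ : ∀ n, (𝒜₂ n).map j₂.toLinearMap ≤ 𝒜 n)
    {d : ℕ} {c₁ : ℕ → A₁} {c₂ : ℕ → A₂}
    (hc₁ : ∀ j ∈ Finset.Icc 1 d, c₁ j ∈ 𝒜₁ j) (hc₂ : ∀ j ∈ Finset.Icc 1 d, c₂ j ∈ 𝒜₂ j)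
    (hc : ∀ j ∈ Finset.Icc 1 d, j₁ (c₁ j) = j₂ (c₂ j))
    (h𝒜0 : 𝒜 0 ≤ 1)
    (h𝒜 : ∀ n, n ≠ 0 → 𝒜 n ≤ ⨆ p : Fin n, 𝒜 p * (𝒜₁ (n - p)).map j₁.toLinearMap ⊔
      𝒜 p * (𝒜₂ (n - p)).map j₂.toLinearMap)
    {N₁ : ℕ → Submodule F A₁} {N₂ : ℕ → Submodule F A₂}
    [∀ n, FiniteDimensional F (N₁ n)] [∀ n, FiniteDimensional F (N₂ n)]
    (hN₁le : ∀ n, N₁ n ≤ 𝒜₁ n) (hN₂le : ∀ n, N₂ n ≤ 𝒜₂ n)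
    (hN₁ : ∀ n, 𝒜₁ n ≤ N₁ n ⊔ rightMultiples 𝒜₁ d c₁ n)
    (hN₂ : ∀ n, 𝒜₂ n ≤ N₂ n ⊔ rightMultiples 𝒜₂ d c₂ n) (n : ℕ) :
    Module.finrank F (𝒜 n) ≤
      altCount (fun b n => cond b (Module.finrank F (N₁ n)) (Module.finrank F (N₂ n))) true n +
      altCount (fun b n => cond b (Module.finrank F (N₁ n)) (Module.finrank F (N₂ n))) false n +
      ∑ j ∈ Finset.Icc 1 (min d n), Module.finrank F (𝒜 (n - j)) := by
  let ℬ : Bool → ℕ → Submodule F A := fun b n =>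
    cond b ((𝒜₁ n).map j₁.toLinearMap) ((𝒜₂ n).map j₂.toLinearMap)
  let N : Bool → ℕ → Submodule F A := fun b n =>
    cond b ((N₁ n).map j₁.toLinearMap) ((N₂ n).map j₂.toLinearMap)
  exact finrank_le_altCount (𝒜 := 𝒜) (ℬ := ℬ) (N := N) (d := d) (c := fun j => j₁ (c₁ j))
    (by
      rintro (_ | _) p q
      · exact Submodule.mul_le.2 fun x hx y hy =>
          (gradedMonoid_map 𝒜₂ j₂).mul_mem hx hy
      · exact Submodule.mul_le.2 fun x hx y hy =>
          (gradedMonoid_map 𝒜₁ j₁).mul_mem hx hy)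
    (by
      rintro (_ | _) n
      · exact hj₂ n
      · exact hj₁ n)
    (by
      rintro (_ | _) n
      · exact Submodule.map_mono (hN₂le n)
      · exact Submodule.map_mono (hN₁le n))
    (by
      rintro (_ | _) n -
      · refine (Submodule.map_mono (hN₂ n)).trans ?_
        rw [Submodule.map_sup]
        refine sup_le_sup le_rfl (Submodule.map_le_iff_le_comap.2 (Finset.sup_le fun j hj => ?_))
        rintro _ ⟨z, hz, rfl⟩
        have hj' := Finset.mem_Icc.1 hj
        have := mul_mem_rightMultiples (ℬ := ℬ false) (c := fun j => j₁ (c₁ j)) hj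
          (show j₂ z ∈ ℬ false (n - j) from ⟨z, hz, rfl⟩)
        simpa [hc j (Finset.mem_Icc.2 ⟨hj'.1, by omega⟩)] using this
      · refine (Submodule.map_mono (hN₁ n)).trans ?_
        rw [Submodule.map_sup]
        refine sup_le_sup le_rfl (Submodule.map_le_iff_le_comap.2 (Finset.sup_le fun j hj => ?_))
        rintro _ ⟨z, hz, rfl⟩
        have := mul_mem_rightMultiples (ℬ := ℬ true) (c := fun j => j₁ (c₁ j)) hj
          (show j₁ z ∈ ℬ true (n - j) from ⟨z, hz, rfl⟩)
        simpa using this)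
    (by
      rintro (_ | _) j hj
      · exact ⟨c₂ j, hc₂ j hj, (hc j hj).symm⟩
      · exact ⟨c₁ j, hc₁ j hj, rfl⟩)
    h𝒜0
    (fun n hn => (h𝒜 n hn).trans (iSup_le fun p => sup_le
      (le_iSup_of_le true (le_iSup (fun p : Fin n => 𝒜 p * ℬ true (n - p)) p))
      (le_iSup_of_le false (le_iSup (fun p : Fin n => 𝒜 p * ℬ false (n - p)) p))))
    _
    (by
      rintro (_ | _) n -
      · exact Submodule.finrank_map_le _ _
      · exact Submodule.finrank_map_le _ _) n

/-- An amalgamated product of noncommutative complete intersections over a free algebra on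
generators `c_1, …, c_d` of degrees `1, …, d`, over which both are free as right modules, is a
noncommutative complete intersection. -/
theorem IsNCCompleteIntersection.amalgam {A₁ A₂ A : Type*} [Ring A₁] [Algebra F A₁] [Ring A₂]
    [Algebra F A₂] [Ring A] [Algebra F A] [Nontrivial A]
    {𝒜₁ : ℕ → Submodule F A₁} {𝒜₂ : ℕ → Submodule F A₂} {𝒜 : ℕ → Submodule F A}
    [SetLike.GradedMonoid 𝒜₁] [SetLike.GradedMonoid 𝒜₂] [SetLike.GradedMonoid 𝒜]
    (h₁ : IsNCCompleteIntersection 𝒜₁) (h₂ : IsNCCompleteIntersection 𝒜₂)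
    (j₁ : A₁ →ₐ[F] A) (j₂ : A₂ →ₐ[F] A)
    (hj₁ : ∀ n, (𝒜₁ n).map j₁.toLinearMap ≤ 𝒜 n) (hj₂ : ∀ n, (𝒜₂ n).map j₂.toLinearMap ≤ 𝒜 n)
    {d : ℕ} {c₁ : ℕ → A₁} {c₂ : ℕ → A₂}
    (hc₁ : ∀ j ∈ Finset.Icc 1 d, c₁ j ∈ 𝒜₁ j) (hc₂ : ∀ j ∈ Finset.Icc 1 d, c₂ j ∈ 𝒜₂ j)
    (hc : ∀ j ∈ Finset.Icc 1 d, j₁ (c₁ j) = j₂ (c₂ j))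
    (hi₁ : ∀ x : ℕ → A₁, ∑ j ∈ Finset.Icc 1 d, x j * c₁ j = 0 → ∀ j ∈ Finset.Icc 1 d, x j = 0)
    (hi₂ : ∀ x : ℕ → A₂, ∑ j ∈ Finset.Icc 1 d, x j * c₂ j = 0 → ∀ j ∈ Finset.Icc 1 d, x j = 0)
    (h𝒜0 : 𝒜 0 ≤ 1) (h𝒜top : ⨆ n, 𝒜 n = ⊤)
    (h𝒜 : ∀ n, n ≠ 0 → 𝒜 n ≤ ⨆ p : Fin n, 𝒜 p * (𝒜₁ (n - p)).map j₁.toLinearMap ⊔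
      𝒜 p * (𝒜₂ (n - p)).map j₂.toLinearMap)
    (huniv : ∀ (Q : Type u) [Ring Q] [Algebra F Q] (f₁ : A₁ →ₐ[F] Q) (f₂ : A₂ →ₐ[F] Q),
      (∀ j ∈ Finset.Icc 1 d, f₁ (c₁ j) = f₂ (c₂ j)) →
        ∃ f : A →ₐ[F] Q, (∀ x, f (j₁ x) = f₁ x) ∧ ∀ x, f (j₂ x) = f₂ x) :
    IsNCCompleteIntersection 𝒜 := by
  obtain ⟨X₁, deg₁, R₁, φ₁, hpos₁, hfin₁, hR₁, hsurj₁, hmap₁, hker₁, hH₁⟩ := h₁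
  obtain ⟨X₂, deg₂, R₂, φ₂, hpos₂, hfin₂, hR₂, hsurj₂, hmap₂, hker₂, hH₂⟩ := h₂
  have fdT₁ := finiteDimensional_freeDegree (F := F) hpos₁ hfin₁
  have fdT₂ := finiteDimensional_freeDegree (F := F) hpos₂ hfin₂
  let deg : X₁ ⊕ X₂ → ℕ := Sum.elim deg₁ deg₂
  have hpos : ∀ x, 0 < deg x := by
    rintro (x | x)
    · exact hpos₁ x
    · exact hpos₂ x
  have hcard := fun n => ncard_sum_elim (hfin₁ n) (hfin₂ n)
  have hfin : ∀ n, {x | deg x = n}.Finite := fun n => (hcard n).1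
  have fdT := finiteDimensional_freeDegree (F := F) hpos hfin
  let i₁ : FreeAlgebra F X₁ →ₐ[F] FreeAlgebra F (X₁ ⊕ X₂) :=
    FreeAlgebra.lift F fun x => FreeAlgebra.ι F (Sum.inl x)
  let i₂ : FreeAlgebra F X₂ →ₐ[F] FreeAlgebra F (X₁ ⊕ X₂) :=
    FreeAlgebra.lift F fun x => FreeAlgebra.ι F (Sum.inr x)
  have hi₁deg : ∀ n, (freeDegree F deg₁ n).map i₁.toLinearMap ≤ freeDegree F deg n :=
    map_freeDegree_le deg₁ _ i₁ fun x => by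
      simpa [i₁] using! ι_mem_freeDegree deg (Sum.inl x)
  have hi₂deg : ∀ n, (freeDegree F deg₂ n).map i₂.toLinearMap ≤ freeDegree F deg n :=
    map_freeDegree_le deg₂ _ i₂ fun x => by
      simpa [i₂] using! ι_mem_freeDegree deg (Sum.inr x)
  let φ : FreeAlgebra F (X₁ ⊕ X₂) →ₐ[F] A := FreeAlgebra.lift F
    (Sum.elim (fun x => j₁ (φ₁ (FreeAlgebra.ι F x))) fun x => j₂ (φ₂ (FreeAlgebra.ι F x)))
  have hφ₁ : ∀ y, φ (i₁ y) = j₁ (φ₁ y) := by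
    have : φ.comp i₁ = j₁.comp φ₁ := by
      ext x; simp [φ, i₁]
    exact fun y => DFunLike.congr_fun this y
  have hφ₂ : ∀ y, φ (i₂ y) = j₂ (φ₂ y) := by
    have : φ.comp i₂ = j₂.comp φ₂ := by
      ext x; simp [φ, i₂]
    exact fun y => DFunLike.congr_fun this y
  have hσ₁ : ∀ j, ∃ σ ∈ freeDegree F deg₁ j, j ∈ Finset.Icc 1 d → φ₁ σ = c₁ j := fun j => by
    by_cases hj : j ∈ Finset.Icc 1 d
    · obtain ⟨σ, h, h'⟩ := (hmap₁ j).ge (hc₁ j hj)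
      exact ⟨σ, h, fun _ => h'⟩
    · exact ⟨0, zero_mem _, fun h => (hj h).elim⟩
  have hσ₂ : ∀ j, ∃ σ ∈ freeDegree F deg₂ j, j ∈ Finset.Icc 1 d → φ₂ σ = c₂ j := fun j => by
    by_cases hj : j ∈ Finset.Icc 1 d
    · obtain ⟨σ, h, h'⟩ := (hmap₂ j).ge (hc₂ j hj)
      exact ⟨σ, h, fun _ => h'⟩
    · exact ⟨0, zero_mem _, fun h => (hj h).elim⟩
  choose σ₁ hσ₁deg hσ₁c using hσ₁
  choose σ₂ hσ₂deg hσ₂c using hσ₂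
  -- The old relations, and in each degree 1 ≤ n ≤ d one new relation identifying lifts of the two
  -- copies of c_n.
  let Rn : ℕ → Submodule F (FreeAlgebra F (X₁ ⊕ X₂)) := fun n =>
    (R₁ ⊓ freeDegree F deg₁ n).map i₁.toLinearMap ⊔
    (R₂ ⊓ freeDegree F deg₂ n).map i₂.toLinearMap ⊔
    Submodule.span F (if n ∈ Finset.Icc 1 d then {i₁ (σ₁ n) - i₂ (σ₂ n)} else ∅)
  have hRn : ∀ n, Rn n ≤ freeDegree F deg n := fun n => by
    refine sup_le (sup_le ((Submodule.map_mono inf_le_right).trans (hi₁deg n))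
      ((Submodule.map_mono inf_le_right).trans (hi₂deg n))) (Submodule.span_le.2 ?_)
    split_ifs
    · rw [Set.singleton_subset_iff]
      exact sub_mem (hi₁deg n ⟨_, hσ₁deg n, rfl⟩) (hi₂deg n ⟨_, hσ₂deg n, rfl⟩)
    · exact Set.empty_subset _
  have hRinf := iSup_inf_freeDegree hRn
  have hRgr : ⨆ n, Rn n = ⨆ n, (⨆ n, Rn n) ⊓ freeDegree F deg n := by
    simp only [hRinf]
  have hR₁le : ∀ r ∈ R₁, i₁ r ∈ ⨆ n, Rn n := fun r hr => by
    have : R₁ ≤ (⨆ n, Rn n).comap i₁.toLinearMap := by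
      rw [hR₁]
      refine iSup_le fun n => ?_
      rw [← Submodule.map_le_iff_le_comap]
      exact le_iSup_of_le n (le_sup_of_le_left le_sup_left)
    exact this hr
  have hR₂le : ∀ r ∈ R₂, i₂ r ∈ ⨆ n, Rn n := fun r hr => by
    have : R₂ ≤ (⨆ n, Rn n).comap i₂.toLinearMap := by
      rw [hR₂]
      refine iSup_le fun n => ?_
      rw [← Submodule.map_le_iff_le_comap]
      exact le_iSup_of_le n (le_sup_of_le_left le_sup_right)
    exact this hr
  have hφR₁ : ∀ r ∈ R₁, φ₁ r = 0 := fun r hr => by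
    rw [← TwoSidedIdeal.mem_ker, hker₁]; exact TwoSidedIdeal.subset_span hr
  have hφR₂ : ∀ r ∈ R₂, φ₂ r = 0 := fun r hr => by
    rw [← TwoSidedIdeal.mem_ker, hker₂]; exact TwoSidedIdeal.subset_span hr
  have hker : TwoSidedIdeal.ker φ =
      TwoSidedIdeal.span ((⨆ n, Rn n : Submodule F _) : Set (FreeAlgebra F (X₁ ⊕ X₂))) := by
    apply le_antisymm
    · set I := TwoSidedIdeal.span
        ((⨆ n, Rn n : Submodule F _) : Set (FreeAlgebra F (X₁ ⊕ X₂))) with hI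
      -- The universal property of the amalgam yields a map from A to T(V)/⟨R⟩ through which the
      -- quotient map factors, so the kernel of `φ` is no larger than ⟨R⟩.
      let mk : FreeAlgebra F (X₁ ⊕ X₂) →ₐ[F] I.ringCon.Quotient := I.ringCon.mkₐ F
      have hmk : ∀ x, mk x = 0 ↔ x ∈ I := fun x => by
        exact (TwoSidedIdeal.mem_ker I.ringCon.mk').symm.trans
          (by rw [TwoSidedIdeal.ker_ringCon_mk'])
      obtain ⟨f₁, hf₁⟩ := exists_comp_eq_of_surjective hsurj₁ (mk.comp i₁) fun x hx => by
        have h : TwoSidedIdeal.span (R₁ : Set (FreeAlgebra F X₁)) ≤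
            TwoSidedIdeal.ker (mk.comp i₁) := TwoSidedIdeal.span_le.2 fun r hr =>
          (TwoSidedIdeal.mem_ker _).2 ((hmk _).2 (TwoSidedIdeal.subset_span (hR₁le r hr)))
        rw [← TwoSidedIdeal.mem_ker, hker₁] at hx
        exact (TwoSidedIdeal.mem_ker _).1 (h hx)
      obtain ⟨f₂, hf₂⟩ := exists_comp_eq_of_surjective hsurj₂ (mk.comp i₂) fun x hx => by
        have h : TwoSidedIdeal.span (R₂ : Set (FreeAlgebra F X₂)) ≤
            TwoSidedIdeal.ker (mk.comp i₂) := TwoSidedIdeal.span_le.2 fun r hr =>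
          (TwoSidedIdeal.mem_ker _).2 ((hmk _).2 (TwoSidedIdeal.subset_span (hR₂le r hr)))
        rw [← TwoSidedIdeal.mem_ker, hker₂] at hx
        exact (TwoSidedIdeal.mem_ker _).1 (h hx)
      obtain ⟨f, hfj₁, hfj₂⟩ := huniv _ f₁ f₂ fun j hj => by
        rw [← hσ₁c j hj, ← hσ₂c j hj, hf₁, hf₂, ← sub_eq_zero, AlgHom.comp_apply,
          AlgHom.comp_apply, ← map_sub, hmk]
        refine TwoSidedIdeal.subset_span (Submodule.mem_iSup_of_mem j ?_)
        refine Submodule.mem_sup_right (Submodule.subset_span ?_)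
        rw [if_pos hj]
        rfl
      have hfφ : f.comp φ = mk := by
        ext x
        rcases x with x | x
        · simp [φ, hfj₁, hf₁, i₁]
        · simp [φ, hfj₂, hf₂, i₂]
      intro x hx
      rw [← hmk, ← hfφ, AlgHom.comp_apply, (TwoSidedIdeal.mem_ker φ).1 hx, map_zero]
    · rw [TwoSidedIdeal.span_le]
      intro r hr
      have : ⨆ n, Rn n ≤ LinearMap.ker φ.toLinearMap := by
        refine iSup_le fun n => sup_le (sup_le ?_ ?_) (Submodule.span_le.2 ?_)
        · rintro _ ⟨r, hr, rfl⟩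
          simp [hφ₁, hφR₁ r hr.1]
        · rintro _ ⟨r, hr, rfl⟩
          simp [hφ₂, hφR₂ r hr.1]
        · split_ifs with hn
          · rw [Set.singleton_subset_iff]
            simp [hφ₁, hφ₂, hσ₁c n hn, hσ₂c n hn, hc n hn]
          · exact Set.empty_subset _
      exact (TwoSidedIdeal.mem_ker φ).2 (this hr)
  have hφmap : ∀ n, (freeDegree F deg n).map φ.toLinearMap = 𝒜 n := fun n => by
    refine le_antisymm (map_freeDegree_le deg 𝒜 φ ?_ n) ?_
    · rintro (x | x)
      · simpa [φ] using! hj₁ _ ⟨_, (hmap₁ _).le ⟨_, ι_mem_freeDegree deg₁ x, rfl⟩, rfl⟩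
      · simpa [φ] using! hj₂ _ ⟨_, (hmap₂ _).le ⟨_, ι_mem_freeDegree deg₂ x, rfl⟩, rfl⟩
    · induction n using Nat.strong_induction_on with
      | _ n ih =>
        rcases eq_or_ne n 0 with rfl | hn
        · refine h𝒜0.trans (Submodule.one_le.2 ⟨1, SetLike.GradedOne.one_mem, map_one φ⟩)
        · refine (h𝒜 n hn).trans (iSup_le fun p => sup_le ?_ ?_)
          · rw [Submodule.mul_le]
            rintro x hx _ ⟨y, hy, rfl⟩
            obtain ⟨w, hw, rfl⟩ := ih p p.2 hx
            obtain ⟨z, hz, rfl⟩ := (hmap₁ _).ge hy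
            have := SetLike.GradedMul.mul_mem hw (hi₁deg _ ⟨z, hz, rfl⟩)
            rw [Nat.add_sub_cancel' p.2.le] at this
            exact ⟨_, this, by simp [hφ₁]⟩
          · rw [Submodule.mul_le]
            rintro x hx _ ⟨y, hy, rfl⟩
            obtain ⟨w, hw, rfl⟩ := ih p p.2 hx
            obtain ⟨z, hz, rfl⟩ := (hmap₂ _).ge hy
            have := SetLike.GradedMul.mul_mem hw (hi₂deg _ ⟨z, hz, rfl⟩)
            rw [Nat.add_sub_cancel' p.2.le] at this
            exact ⟨_, this, by simp [hφ₂]⟩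
  have hsurj : Function.Surjective φ := by
    have : LinearMap.range φ.toLinearMap = ⊤ := by
      rw [eq_top_iff, ← h𝒜top]
      refine iSup_le fun n => ?_
      rw [← hφmap n]
      exact LinearMap.map_le_range
    exact LinearMap.range_eq_top.1 this
  have fd₁ : ∀ n, FiniteDimensional F (𝒜₁ n) := fun n => by rw [← hmap₁]; infer_instance
  have fd₂ : ∀ n, FiniteDimensional F (𝒜₂ n) := fun n => by rw [← hmap₂]; infer_instance
  have fd : ∀ n, FiniteDimensional F (𝒜 n) := fun n => by rw [← hφmap]; infer_instance
  obtain ⟨N₁, hN₁le, hN₁, hν₁⟩ := exists_complement_rightMultiples hc₁ hi₁ hH₁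
  obtain ⟨N₂, hN₂le, hN₂, hν₂⟩ := exists_complement_rightMultiples hc₂ hi₂ hH₂
  have fdN₁ : ∀ n, FiniteDimensional F (N₁ n) := fun n =>
    Submodule.finiteDimensional_of_le (hN₁le n)
  have fdN₂ : ∀ n, FiniteDimensional F (N₂ n) := fun n =>
    Submodule.finiteDimensional_of_le (hN₂le n)
  have hup := finrank_amalgam_le j₁ j₂ hj₁ hj₂ hc₁ hc₂ hc h𝒜0 h𝒜 hN₁le hN₂le hN₁ hN₂
  have hlow := coeff_one_le_golodShafarevich 𝒜 hpos hfin _ hRgr φ hφmap hker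
  refine ⟨X₁ ⊕ X₂, deg, ⨆ n, Rn n, φ, hpos, hfin, hRgr, hsurj, hφmap, hker, ?_⟩
  refine mul_eq_one_of_bounds (d := d) (ν := fun b n =>
    cond b (Module.finrank F (N₁ n)) (Module.finrank F (N₂ n))) hH₁ hH₂ hν₁ hν₂ (fun n => ?_) (fun n => ?_)
    (fun n => ?_) hlow
  · rw [gradedDim, PowerSeries.coeff_mk]; positivity
  · have e : gradedDim 𝒜 = PowerSeries.mk fun k => (Module.finrank F (𝒜 k) : ℤ) := rfl
    rw [mul_sub, mul_one, map_sub, map_sub, map_add, e, coeff_mul_truncGeom, PowerSeries.coeff_mk,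
      PowerSeries.coeff_mk, PowerSeries.coeff_mk, PowerSeries.coeff_one]
    split_ifs with hn
    -- In degree 0 both counts contain the empty word; the −1 removes one of them.
    · subst hn
      have : Module.finrank F (𝒜 0) ≤ 1 := by
        refine (Submodule.finrank_mono (h𝒜0.trans (Submodule.one_eq_span).le)).trans ?_
        exact (finrank_span_le_card ({1} : Set A)).trans (by simp)
      simp [altCount_zero]
      omega
    · have := hup n
      rw [sub_zero]
      zify at this
      linarith
  · have hdim : Module.finrank F ↥((⨆ n, Rn n) ⊓ freeDegree F deg n) ≤
        Module.finrank F ↥(R₁ ⊓ freeDegree F deg₁ n) +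
        Module.finrank F ↥(R₂ ⊓ freeDegree F deg₂ n) + if n ∈ Finset.Icc 1 d then 1 else 0 := by
      rw [hRinf]
      have a₁ := Submodule.finrank_map_le i₁.toLinearMap (R₁ ⊓ freeDegree F deg₁ n)
      have a₂ := Submodule.finrank_map_le i₂.toLinearMap (R₂ ⊓ freeDegree F deg₂ n)
      have a₃ := finrank_span_ite_singleton_le (F := F) (n ∈ Finset.Icc 1 d)
        (i₁ (σ₁ n) - i₂ (σ₂ n))
      exact (Submodule.finrank_add_le_finrank_add_finrank _ _).trans (add_le_add
        ((Submodule.finrank_add_le_finrank_add_finrank _ _).trans (add_le_add a₁ a₂)) a₃)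
    have hc := (hcard n).2
    simp only [map_add, map_sub, PowerSeries.coeff_mk, gradedDim, truncGeom, deg, hc]
    zify at hdim
    push_cast
    linarith

end Amalgam

/-! ### Functoriality of A(Γ) and its generators. -/

namespace GenLayeredGraph

section Map

variable {V E V' E' : Type*} {Γ' : GenLayeredGraph V' E'} {Γ : GenLayeredGraph V E}
  {F : Type*} [Field F]

theorem algHom_pathCoeff_map {B : Type*} [Ring B] [Algebra F B]
    (g' : FreeAlgebra F Γ'.Gen →ₐ[F] B) (g : FreeAlgebra F Γ.Gen →ₐ[F] B) (f : E' → E)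
    (h : ∀ e n, g' (Γ'.a F e n) = g (Γ.a F (f e) n)) (π : List E') (n : ℕ) :
    g' (Γ'.pathCoeff F π n) = g (Γ.pathCoeff F (π.map f) n) := by
  have hpoly : Polynomial.mapRingHom g'.toRingHom (Γ'.pathPoly F π) =
      Polynomial.mapRingHom g.toRingHom (Γ.pathPoly F (π.map f)) := by
    induction π with
    | nil => simp [pathPoly]
    | cons e π ih =>
      simp only [pathPoly, List.map_cons, List.prod_cons, map_mul] at ih ⊢
      rw [ih]
      congr 1
      ext k
      rw [coe_mapRingHom, coe_mapRingHom, coeff_map, coeff_map, coeff_edgePoly, coeff_edgePoly]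
      simpa using congrArg (fun z => (-1) ^ k * z) (h e k)
  have := congrArg (fun p => coeff p n) hpoly
  simp only [coe_mapRingHom, coeff_map] at this
  rw [pathCoeff, pathCoeff, map_mul, map_mul]
  simpa using congrArg (fun z => (-1) ^ n * z) this

theorem IsPath.map {κ : V' → V} {f : E' → E} (ht : ∀ e, Γ.tail (f e) = κ (Γ'.tail e))
    (hh : ∀ e, Γ.head (f e) = κ (Γ'.head e)) {v w : V'} {π : List E'} (h : Γ'.IsPath v w π) :
    Γ.IsPath (κ v) (κ w) (π.map f) := by
  induction h with
  | single e =>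
    rw [← ht, ← hh]
    exact IsPath.single (f e)
  | cons e _ ih =>
    rw [← hh] at ih
    rw [← ht]
    exact IsPath.cons (f e) ih

/-- A rank preserving map of graphs induces a homomorphism of algebras. -/
theorem exists_algHom {κ : V' → V} {f : E' → E} (ht : ∀ e, Γ.tail (f e) = κ (Γ'.tail e))
    (hh : ∀ e, Γ.head (f e) = κ (Γ'.head e)) (hr : ∀ v, Γ.rank (κ v) = Γ'.rank v) :
    ∃ j : Γ'.Alg F →ₐ[F] Γ.Alg F, ∀ e n, j (RingQuot.mkAlgHom F (Γ'.Rel F) (Γ'.a F e n)) =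
      RingQuot.mkAlgHom F (Γ.Rel F) (Γ.a F (f e) n) := by
  let g : FreeAlgebra F Γ'.Gen →ₐ[F] Γ.Alg F := FreeAlgebra.lift F fun x =>
    RingQuot.mkAlgHom F (Γ.Rel F) (Γ.a F (f x.edge) (Γ'.genDeg x))
  have hlen : ∀ e, Γ.len (f e) = Γ'.len e := fun e => by
    rw [len, len, ht, hh, hr, hr]
  have hg : ∀ e n, g (Γ'.a F e n) = RingQuot.mkAlgHom F (Γ.Rel F) (Γ.a F (f e) n) := fun e n => by
    rcases Γ'.a_cases F e n with ⟨h, ha⟩ | ⟨rfl, ha⟩ | ⟨h, ha⟩ <;> rw [ha]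
    · exact FreeAlgebra.lift_ι_apply _ _
    · rw [a_zero, map_one, map_one]
    · rw [a_eq_zero Γ F (by rwa [hlen]), map_zero, map_zero]
  refine ⟨RingQuot.liftAlgHom F ⟨g, ?_⟩, fun e n => ?_⟩
  · rintro _ _ ⟨h₁, h₂, hj, hj'⟩
    rw [algHom_pathCoeff_map g (RingQuot.mkAlgHom F (Γ.Rel F)) f hg,
      algHom_pathCoeff_map g (RingQuot.mkAlgHom F (Γ.Rel F)) f hg]
    exact RingQuot.mkAlgHom_rel F (Rel.mk (h₁.map ht hh) (h₂.map ht hh) hj (by rwa [hr, hr]))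
  · rw [← hg]
    exact RingQuot.liftAlgHom_mkAlgHom_apply F _ _ _

end Map

section Degree

variable {V E : Type*} (Γ : GenLayeredGraph V E) (F : Type*) [Field F]

theorem a_mem_algDegree (e : E) (n : ℕ) :
    RingQuot.mkAlgHom F (Γ.Rel F) (Γ.a F e n) ∈ Γ.algDegree F n :=
  ⟨_, Γ.a_mem_freeDegree F e n, rfl⟩

theorem algDegree_zero_le : Γ.algDegree F 0 ≤ 1 := by
  rw [algDegree, freeDegree_zero fun g => g.2.1, Submodule.map_one]

theorem iSup_algDegree : ⨆ n, Γ.algDegree F n = ⊤ := by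
  simp only [algDegree]
  rw [← Submodule.map_iSup, iSup_freeDegree, Submodule.map_top, LinearMap.range_eq_top]
  exact RingQuot.mkAlgHom_surjective F (Γ.Rel F)

variable {Γ} {F} in
theorem map_algDegree_le {A : Type*} [Ring A] [Algebra F A] (𝒜 : ℕ → Submodule F A)
    [SetLike.GradedMonoid 𝒜] (f : Γ.Alg F →ₐ[F] A)
    (hf : ∀ e n, f (RingQuot.mkAlgHom F (Γ.Rel F) (Γ.a F e n)) ∈ 𝒜 n) (n : ℕ) :
    (Γ.algDegree F n).map f.toLinearMap ≤ 𝒜 n := by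
  have := map_freeDegree_le Γ.genDeg 𝒜 (f.comp (RingQuot.mkAlgHom F (Γ.Rel F))) (fun g => by
    rw [← a_edge_genDeg]
    exact hf _ _) n
  rw [algDegree, ← Submodule.map_comp]
  exact this

/-- Split off the last letter of a word, which has positive degree. -/
theorem algDegree_le_iSup_mul {n : ℕ} (hn : n ≠ 0) (P : ℕ → Submodule F (Γ.Alg F))
    (hP : ∀ e n, RingQuot.mkAlgHom F (Γ.Rel F) (Γ.a F e n) ∈ P n) :
    Γ.algDegree F n ≤ ⨆ p : Fin n, Γ.algDegree F p * P (n - p) := by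
  rw [algDegree, freeDegree, Submodule.map_span_le]
  rintro _ ⟨w, hw, rfl⟩
  rcases List.eq_nil_or_concat w with rfl | ⟨w, g, rfl⟩
  · exact (hn (by simpa using hw.symm)).elim
  · have hg : 1 ≤ Γ.genDeg g := g.2.1
    simp only [List.concat_eq_append, List.map_append, List.sum_append, List.map_cons,
      List.map_nil, List.sum_cons, List.sum_nil, add_zero, List.prod_append, List.prod_cons,
      List.prod_nil, mul_one] at hw ⊢
    refine Submodule.mem_iSup_of_mem ⟨(w.map Γ.genDeg).sum, by omega⟩ ?_
    rw [AlgHom.toLinearMap_apply, map_mul]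
    refine Submodule.mul_mem_mul ⟨_, Submodule.subset_span ⟨w, rfl, rfl⟩, rfl⟩ ?_
    rw [← a_edge_genDeg, show n - (w.map Γ.genDeg).sum = Γ.genDeg g by omega]
    exact hP _ _

theorem IsUniqueMinimal.eq_of_rank_eq_zero {m : V} (hm : Γ.IsUniqueMinimal m) {v : V}
    (hv : Γ.rank v = 0) : v = m :=
  (hm v).1 fun w ⟨_, hπ⟩ => by have := hπ.rank_lt; omega

theorem exists_path {d : ℕ} (hd : d ≠ 0) {m M : V} (hm : Γ.IsUniqueMinimal m)
    (hm0 : Γ.rank m = 0) (hMd : Γ.rank M = d) : ∃ π, Γ.IsPath M m π :=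
  hm.above M fun h => hd (by rw [← hMd, h, hm0])

/-- The coefficients of `P_π` in `A(Γ)` for the paths `π` from the maximal to the minimal vertex. -/
theorem exists_topCoeff {d : ℕ} {m M : V} (hm : Γ.IsUniqueMinimal m) (hm0 : Γ.rank m = 0)
    (hM : Γ.IsUniqueMaximal M) (hMd : Γ.rank M = d) :
    ∃ c : ℕ → Γ.Alg F,
      (∀ π, Γ.IsPath M m π → ∀ j ∈ Finset.Icc 1 d,
        RingQuot.mkAlgHom F (Γ.Rel F) (Γ.pathCoeff F π j) = c j) ∧
      (∀ j ∈ Finset.Icc 1 d, c j ∈ Γ.algDegree F j) ∧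
      ∀ x : ℕ → Γ.Alg F, ∑ j ∈ Finset.Icc 1 d, x j * c j = 0 →
        ∀ j ∈ Finset.Icc 1 d, x j = 0 := by
  -- For d = 0 the index set is empty and any family will do.
  rcases eq_or_ne d 0 with rfl | hd
  · exact ⟨0, by simp, by simp, by simp⟩
  · obtain ⟨π, hπ⟩ := Γ.exists_path hd hm hm0 hMd
    refine ⟨fun j => RingQuot.mkAlgHom F (Γ.Rel F) (Γ.pathCoeff F π j), fun π' hπ' j hj => ?_,
      fun j _ => ⟨_, Γ.pathCoeff_mem_freeDegree F π j, rfl⟩, fun x hx j hj =>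
      Γ.eq_zero_of_sum_mul_pathCoeff_eq_zero F (IsUniqueMaximal.head_ne Γ hM) hMd hm0 hπ x hx hj⟩
    have hj' := Finset.mem_Icc.1 hj
    exact RingQuot.mkAlgHom_rel F (Rel.mk hπ' hπ hj'.1 (by omega))

end Degree

/-! ### Vertices of the glued graph. -/

section Glue

variable {V₁ V₂ : Type*} {m₁ M₁ : V₁} {m₂ M₂ : V₂}

open Classical in
-- Moving the two glued vertices of V₂ into V₁ descends to the quotient and separates its points.
-- The hypothesis makes this well defined when m₂ = M₂.
theorem glue_cases_inl (h : m₂ = M₂ → m₁ = M₁) {a : V₁} {x : V₁ ⊕ V₂}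
    (hx : Quot.mk (Glue m₁ M₁ m₂ M₂) (Sum.inl a) = Quot.mk _ x) :
    x = Sum.inl a ∨ (a = m₁ ∧ x = Sum.inr m₂) ∨ (a = M₁ ∧ x = Sum.inr M₂) := by
  let κ : V₁ ⊕ V₂ → V₁ ⊕ V₂ := Sum.elim Sum.inl fun b =>
    if b = m₂ then Sum.inl m₁ else if b = M₂ then Sum.inl M₁ else Sum.inr b
  have hκ : ∀ x y, Glue m₁ M₁ m₂ M₂ x y → κ x = κ y := by
    rintro _ _ (_ | _)
    · simp [κ]
    · by_cases hM : M₂ = m₂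
      · simp [κ, hM, h hM.symm]
      · simp [κ, hM]
  have := congrArg (Quot.lift κ hκ) hx
  rcases x with b | b
  · left
    simpa [κ, eq_comm] using this
  · right
    simp only [κ, Sum.elim_inl, Sum.elim_inr] at this
    split_ifs at this with h1 h2
    · exact .inl ⟨Sum.inl_injective this, by rw [h1]⟩
    · exact .inr ⟨Sum.inl_injective this, by rw [h2]⟩

open Classical in
theorem glue_inr_injective (h : m₁ = M₁ → m₂ = M₂) {a b : V₂}
    (hx : Quot.mk (Glue m₁ M₁ m₂ M₂) (Sum.inr a) = Quot.mk _ (Sum.inr b)) : a = b := by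
  let κ : V₁ ⊕ V₂ → V₁ ⊕ V₂ := Sum.elim
    (fun a => if a = m₁ then Sum.inr m₂ else if a = M₁ then Sum.inr M₂ else Sum.inl a) Sum.inr
  have hκ : ∀ x y, Glue m₁ M₁ m₂ M₂ x y → κ x = κ y := by
    rintro _ _ (_ | _)
    · simp [κ]
    · by_cases hM : M₁ = m₁
      · simp [κ, hM, h hM.symm]
      · simp [κ, hM]
  exact Sum.inr_injective (congrArg (Quot.lift κ hκ) hx)

end Glue

/-! ### Paths and the universal property of the double bouquet. -/

section DoubleBouquet

variable {V₁ E₁ V₂ E₂ : Type*} {Γ₁ : GenLayeredGraph V₁ E₁} {Γ₂ : GenLayeredGraph V₂ E₂}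
  {m₁ M₁ : V₁} {m₂ M₂ : V₂} {hr : Γ₁.rank m₁ = Γ₂.rank m₂} {hr' : Γ₁.rank M₁ = Γ₂.rank M₂}

theorem IsPath.exists_tail {V E : Type*} {Γ : GenLayeredGraph V E} {v w : V} {π : List E}
    (h : Γ.IsPath v w π) : ∃ e, Γ.tail e = v := by
  cases h <;> exact ⟨_, rfl⟩

theorem IsPath.exists_head {V E : Type*} {Γ : GenLayeredGraph V E} {v w : V} {π : List E}
    (h : Γ.IsPath v w π) : ∃ e, Γ.head e = w := by
  induction h with
  | single e => exact ⟨e, rfl⟩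
  | cons _ _ ih => exact ih

/-- A path could change sides only at a glued vertex, by entering the maximal vertex or leaving the
minimal one; neither is possible. -/
theorem isPath_doubleBouquet (hm₁ : Γ₁.IsUniqueMinimal m₁) (hM₁ : Γ₁.IsUniqueMaximal M₁)
    (hm₂ : Γ₂.IsUniqueMinimal m₂) (hM₂ : Γ₂.IsUniqueMaximal M₂)
    (h₁ : m₁ = M₁ → m₂ = M₂) (h₂ : m₂ = M₂ → m₁ = M₁)
    {v w : Quot (Glue m₁ M₁ m₂ M₂)} {π : List (E₁ ⊕ E₂)}
    (h : (Γ₁.doubleBouquet Γ₂ m₁ M₁ m₂ M₂ hr hr').IsPath v w π) :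
    (∃ v' w' π', Γ₁.IsPath v' w' π' ∧ v = Quot.mk _ (Sum.inl v') ∧
      w = Quot.mk _ (Sum.inl w') ∧ π = π'.map Sum.inl) ∨
    (∃ v' w' π', Γ₂.IsPath v' w' π' ∧ v = Quot.mk _ (Sum.inr v') ∧
      w = Quot.mk _ (Sum.inr w') ∧ π = π'.map Sum.inr) := by
  induction h with
  | single e =>
    rcases e with e | e
    · exact .inl ⟨_, _, [e], IsPath.single e, rfl, rfl, rfl⟩
    · exact .inr ⟨_, _, [e], IsPath.single e, rfl, rfl, rfl⟩
  | cons e _ ih =>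
    rcases e with e | e
    · left
      rcases ih with ⟨v', w', π', hπ, hv, hw, rfl⟩ | ⟨v', w', π', hπ, hv, hw, rfl⟩
      · rcases glue_cases_inl h₂ hv with h | ⟨-, h⟩ | ⟨-, h⟩ <;> cases h
        exact ⟨_, _, e :: π', IsPath.cons e hπ, rfl, hw, rfl⟩
      · rcases glue_cases_inl h₂ hv with h | ⟨h', h⟩ | ⟨h', h⟩ <;> cases h
        · obtain ⟨e', he'⟩ := hπ.exists_tail
          exact (IsUniqueMinimal.tail_ne Γ₂ hm₂ e' he').elim
        · exact (IsUniqueMaximal.head_ne Γ₁ hM₁ e h').elim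
    · right
      rcases ih with ⟨v', w', π', hπ, hv, hw, rfl⟩ | ⟨v', w', π', hπ, hv, hw, rfl⟩
      · rcases glue_cases_inl h₂ hv.symm with h | ⟨h', h⟩ | ⟨h', h⟩
        · cases h
        · subst h'
          obtain ⟨e', he'⟩ := hπ.exists_tail
          exact (IsUniqueMinimal.tail_ne Γ₁ hm₁ e' he').elim
        · exact (IsUniqueMaximal.head_ne Γ₂ hM₂ e (Sum.inr_injective h)).elim
      · have := glue_inr_injective h₁ hv
        subst this
        exact ⟨_, _, e :: π', IsPath.cons e hπ, rfl, hw, rfl⟩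

variable {F : Type*} [Field F]

/-- `A(Γ₁ ◇ Γ₂)` is the amalgam of `A(Γ₁)` and `A(Γ₂)` along the coefficients of `P_π` for the
paths `π` from the maximal to the minimal vertex. -/
theorem exists_algHom_doubleBouquet {d : ℕ}
    (hm₁ : Γ₁.IsUniqueMinimal m₁) (hM₁ : Γ₁.IsUniqueMaximal M₁)
    (hm₂ : Γ₂.IsUniqueMinimal m₂) (hM₂ : Γ₂.IsUniqueMaximal M₂)
    (h₁ : m₁ = M₁ → m₂ = M₂) (h₂ : m₂ = M₂ → m₁ = M₁)
    (hm₁0 : Γ₁.rank m₁ = 0) (hM₁d : Γ₁.rank M₁ = d)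
    {c₁ : ℕ → Γ₁.Alg F} {c₂ : ℕ → Γ₂.Alg F}
    (hc₁ : ∀ π, Γ₁.IsPath M₁ m₁ π → ∀ j ∈ Finset.Icc 1 d,
      RingQuot.mkAlgHom F (Γ₁.Rel F) (Γ₁.pathCoeff F π j) = c₁ j)
    (hc₂ : ∀ π, Γ₂.IsPath M₂ m₂ π → ∀ j ∈ Finset.Icc 1 d,
      RingQuot.mkAlgHom F (Γ₂.Rel F) (Γ₂.pathCoeff F π j) = c₂ j)
    {Q : Type*} [Ring Q] [Algebra F Q] (f₁ : Γ₁.Alg F →ₐ[F] Q) (f₂ : Γ₂.Alg F →ₐ[F] Q)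
    (hf : ∀ j ∈ Finset.Icc 1 d, f₁ (c₁ j) = f₂ (c₂ j)) :
    ∃ f : (Γ₁.doubleBouquet Γ₂ m₁ M₁ m₂ M₂ hr hr').Alg F →ₐ[F] Q,
      (∀ e n, f (RingQuot.mkAlgHom F _
        ((Γ₁.doubleBouquet Γ₂ m₁ M₁ m₂ M₂ hr hr').a F (Sum.inl e) n)) =
          f₁ (RingQuot.mkAlgHom F _ (Γ₁.a F e n))) ∧
      ∀ e n, f (RingQuot.mkAlgHom F _
        ((Γ₁.doubleBouquet Γ₂ m₁ M₁ m₂ M₂ hr hr').a F (Sum.inr e) n)) =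
          f₂ (RingQuot.mkAlgHom F _ (Γ₂.a F e n)) := by
  set Γ := Γ₁.doubleBouquet Γ₂ m₁ M₁ m₂ M₂ hr hr' with hΓ
  have hlen₁ : ∀ e, Γ.len (Sum.inl e) = Γ₁.len e := fun e => rfl
  have hlen₂ : ∀ e, Γ.len (Sum.inr e) = Γ₂.len e := fun e => rfl
  let q₁ := RingQuot.mkAlgHom F (Γ₁.Rel F)
  let q₂ := RingQuot.mkAlgHom F (Γ₂.Rel F)
  let g : FreeAlgebra F Γ.Gen →ₐ[F] Q := FreeAlgebra.lift F fun x =>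
    Sum.elim (fun e => f₁ (q₁ (Γ₁.a F e (Γ.genDeg x)))) (fun e => f₂ (q₂ (Γ₂.a F e (Γ.genDeg x))))
      x.edge
  have hgι : ∀ x, g (FreeAlgebra.ι F x) = Sum.elim (fun e => f₁ (q₁ (Γ₁.a F e (Γ.genDeg x))))
      (fun e => f₂ (q₂ (Γ₂.a F e (Γ.genDeg x)))) x.edge := fun x => by
    simp only [g, FreeAlgebra.lift_ι_apply]
  have hg₁ : ∀ e n, (f₁.comp q₁) (Γ₁.a F e n) = g (Γ.a F (Sum.inl e) n) := fun e n => by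
    rcases Γ.a_cases F (Sum.inl e) n with ⟨h, ha⟩ | ⟨rfl, ha⟩ | ⟨h, ha⟩ <;> rw [ha]
    · exact (hgι (Γ.gen (Sum.inl e) n h)).symm
    · rw [a_zero, map_one, map_one]
    · rw [a_eq_zero Γ₁ F (by rwa [hlen₁] at h), map_zero, map_zero]
  have hg₂ : ∀ e n, (f₂.comp q₂) (Γ₂.a F e n) = g (Γ.a F (Sum.inr e) n) := fun e n => by
    rcases Γ.a_cases F (Sum.inr e) n with ⟨h, ha⟩ | ⟨rfl, ha⟩ | ⟨h, ha⟩ <;> rw [ha]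
    · exact (hgι (Γ.gen (Sum.inr e) n h)).symm
    · rw [a_zero, map_one, map_one]
    · rw [a_eq_zero Γ₂ F (by rwa [hlen₂] at h), map_zero, map_zero]
  have hp₁ := algHom_pathCoeff_map (f₁.comp q₁) g Sum.inl hg₁
  have hp₂ := algHom_pathCoeff_map (f₂.comp q₂) g Sum.inr hg₂
  -- Parallel paths on different sides must run from the maximal to the minimal vertex, and their
  -- relation is the assumed agreement of the c_j.
  have hmixed : ∀ {v₁ w₁ : V₁} {v₂ w₂ : V₂} {π₁ : List E₁} {π₂ : List E₂} {j : ℕ},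
      Γ₁.IsPath v₁ w₁ π₁ → Γ₂.IsPath v₂ w₂ π₂ →
      Quot.mk (Glue m₁ M₁ m₂ M₂) (Sum.inl v₁) = Quot.mk _ (Sum.inr v₂) →
      Quot.mk (Glue m₁ M₁ m₂ M₂) (Sum.inl w₁) = Quot.mk _ (Sum.inr w₂) → 1 ≤ j →
      j ≤ Γ₁.rank v₁ - Γ₁.rank w₁ →
      g (Γ.pathCoeff F (π₁.map Sum.inl) j) = g (Γ.pathCoeff F (π₂.map Sum.inr) j) := by
    intro v₁ w₁ v₂ w₂ π₁ π₂ j hπ₁ hπ₂ hv hw hj hj'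
    obtain ⟨e₁, he₁⟩ := hπ₁.exists_tail
    obtain ⟨e₂, he₂⟩ := hπ₁.exists_head
    rcases glue_cases_inl h₂ hv with h | ⟨rfl, h⟩ | ⟨rfl, h⟩ <;> cases h
    · exact (IsUniqueMinimal.tail_ne Γ₁ hm₁ e₁ he₁).elim
    rcases glue_cases_inl h₂ hw with h | ⟨rfl, h⟩ | ⟨rfl, h⟩ <;> cases h
    · have hj'' : j ∈ Finset.Icc 1 d := Finset.mem_Icc.2 ⟨hj, by omega⟩
      rw [← hp₁, ← hp₂, AlgHom.comp_apply, AlgHom.comp_apply, hc₁ _ hπ₁ j hj'',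
        hc₂ _ hπ₂ j hj'', hf j hj'']
    · exact (IsUniqueMaximal.head_ne Γ₁ hM₁ e₂ he₂).elim
  have hrel : ∀ ⦃x y⦄, Γ.Rel F x y → g x = g y := by
    rintro _ _ ⟨hπ, hπ', hj, hj'⟩
    rcases isPath_doubleBouquet hm₁ hM₁ hm₂ hM₂ h₁ h₂ hπ with
      ⟨v, w, π, hp, rfl, rfl, rfl⟩ | ⟨v, w, π, hp, rfl, rfl, rfl⟩ <;>
    rcases isPath_doubleBouquet hm₁ hM₁ hm₂ hM₂ h₁ h₂ hπ' with
      ⟨v', w', π', hp', hv, hw, rfl⟩ | ⟨v', w', π', hp', hv, hw, rfl⟩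
    · rcases glue_cases_inl h₂ hv with h | ⟨-, h⟩ | ⟨-, h⟩ <;> cases h
      rcases glue_cases_inl h₂ hw with h | ⟨-, h⟩ | ⟨-, h⟩ <;> cases h
      rw [← hp₁, ← hp₁, AlgHom.comp_apply, AlgHom.comp_apply]
      exact congrArg f₁ (RingQuot.mkAlgHom_rel F (Rel.mk hp hp' hj hj'))
    · exact hmixed hp hp' hv hw hj hj'
    · refine (hmixed hp' hp hv.symm hw.symm hj ?_).symm
      have e₁ : Γ.rank (Quot.mk _ (Sum.inr v)) = Γ₁.rank v' := by rw [hv]; rfl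
      have e₂ : Γ.rank (Quot.mk _ (Sum.inr w)) = Γ₁.rank w' := by rw [hw]; rfl
      rwa [e₁, e₂] at hj'
    · have hv' := glue_inr_injective h₁ hv
      have hw' := glue_inr_injective h₁ hw
      subst hv' hw'
      rw [← hp₂, ← hp₂, AlgHom.comp_apply, AlgHom.comp_apply]
      exact congrArg f₂ (RingQuot.mkAlgHom_rel F (Rel.mk hp hp' hj hj'))
  refine ⟨RingQuot.liftAlgHom F ⟨g, hrel⟩, fun e n => ?_, fun e n => ?_⟩
  · rw [RingQuot.liftAlgHom_mkAlgHom_apply, ← hg₁]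
    rfl
  · rw [RingQuot.liftAlgHom_mkAlgHom_apply, ← hg₂]
    rfl

theorem algHom_ext {V E : Type*} {Γ : GenLayeredGraph V E} {Q : Type*} [Ring Q] [Algebra F Q]
    {f g : Γ.Alg F →ₐ[F] Q} (h : ∀ e n, f (RingQuot.mkAlgHom F (Γ.Rel F) (Γ.a F e n)) =
      g (RingQuot.mkAlgHom F (Γ.Rel F) (Γ.a F e n))) (x : Γ.Alg F) : f x = g x := by
  have : f = g := RingQuot.ringQuot_ext' _ _ _ (FreeAlgebra.hom_ext (funext fun x => by
    simp only [Function.comp_apply, AlgHom.comp_apply]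
    rw [← a_edge_genDeg]
    exact h _ _))
  rw [this]

end DoubleBouquet

end GenLayeredGraph

/-! ### The double bouquet as an amalgam. -/

theorem corollary5p8 {F : Type*} [Field F] {V₁ E₁ V₂ E₂ : Type*}
    (Γ₁ : GenLayeredGraph V₁ E₁) (Γ₂ : GenLayeredGraph V₂ E₂) (d : ℕ)
    (m₁ M₁ : V₁) (m₂ M₂ : V₂)
    (hm₁ : Γ₁.IsUniqueMinimal m₁) (hm₁0 : Γ₁.rank m₁ = 0)
    (hM₁ : Γ₁.IsUniqueMaximal M₁) (hM₁d : Γ₁.rank M₁ = d)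
    (hm₂ : Γ₂.IsUniqueMinimal m₂) (hm₂0 : Γ₂.rank m₂ = 0)
    (hM₂ : Γ₂.IsUniqueMaximal M₂) (hM₂d : Γ₂.rank M₂ = d)
    (h₁ : IsNCCompleteIntersection (Γ₁.algDegree F))
    (h₂ : IsNCCompleteIntersection (Γ₂.algDegree F)) :
    IsNCCompleteIntersection
      ((Γ₁.doubleBouquet Γ₂ m₁ M₁ m₂ M₂ (hm₁0.trans hm₂0.symm)
        (hM₁d.trans hM₂d.symm)).algDegree F) := by
  set Γ := Γ₁.doubleBouquet Γ₂ m₁ M₁ m₂ M₂ (hm₁0.trans hm₂0.symm) (hM₁d.trans hM₂d.symm) with hΓ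
  -- If the ends coincide in one graph then d = 0, and a vertex of rank 0 is minimal, so they
  -- coincide in the other.
  have e₁ : m₁ = M₁ → m₂ = M₂ := fun h =>
    (hm₂.eq_of_rank_eq_zero Γ₂ (by rw [hM₂d, ← hM₁d, ← h, hm₁0])).symm
  have e₂ : m₂ = M₂ → m₁ = M₁ := fun h =>
    (hm₁.eq_of_rank_eq_zero Γ₁ (by rw [hM₁d, ← hM₂d, ← h, hm₂0])).symm
  obtain ⟨c₁, hc₁, hc₁deg, hi₁⟩ := Γ₁.exists_topCoeff F hm₁ hm₁0 hM₁ hM₁d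
  obtain ⟨c₂, hc₂, hc₂deg, hi₂⟩ := Γ₂.exists_topCoeff F hm₂ hm₂0 hM₂ hM₂d
  obtain ⟨j₁, hj₁⟩ := GenLayeredGraph.exists_algHom (F := F) (Γ' := Γ₁) (Γ := Γ)
    (κ := fun v => Quot.mk _ (Sum.inl v)) (f := Sum.inl) (fun _ => rfl) (fun _ => rfl)
    fun _ => rfl
  obtain ⟨j₂, hj₂⟩ := GenLayeredGraph.exists_algHom (F := F) (Γ' := Γ₂) (Γ := Γ)
    (κ := fun v => Quot.mk _ (Sum.inr v)) (f := Sum.inr) (fun _ => rfl) (fun _ => rfl)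
    fun _ => rfl
  refine IsNCCompleteIntersection.amalgam (d := d) h₁ h₂ j₁ j₂
    (GenLayeredGraph.map_algDegree_le _ j₁ fun e n => by rw [hj₁]; exact Γ.a_mem_algDegree F _ n)
    (GenLayeredGraph.map_algDegree_le _ j₂ fun e n => by rw [hj₂]; exact Γ.a_mem_algDegree F _ n)
    hc₁deg hc₂deg (fun j hj => ?_) hi₁ hi₂ (Γ.algDegree_zero_le F) (Γ.iSup_algDegree F)
    (fun n hn => ?_) fun Q _ _ f₁ f₂ hf => ?_
  · have hj' := Finset.mem_Icc.1 hj
    obtain ⟨π₁, hπ₁⟩ := Γ₁.exists_path (by omega) hm₁ hm₁0 hM₁d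
    obtain ⟨π₂, hπ₂⟩ := Γ₂.exists_path (by omega) hm₂ hm₂0 hM₂d
    rw [← hc₁ π₁ hπ₁ j hj, ← hc₂ π₂ hπ₂ j hj]
    have a₁ := GenLayeredGraph.algHom_pathCoeff_map (j₁.comp (RingQuot.mkAlgHom F (Γ₁.Rel F)))
      (RingQuot.mkAlgHom F (Γ.Rel F)) Sum.inl hj₁ π₁ j
    have a₂ := GenLayeredGraph.algHom_pathCoeff_map (j₂.comp (RingQuot.mkAlgHom F (Γ₂.Rel F)))
      (RingQuot.mkAlgHom F (Γ.Rel F)) Sum.inr hj₂ π₂ j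
    rw [AlgHom.comp_apply] at a₁ a₂
    rw [a₁, a₂]
    have p₁ : Γ.IsPath (Quot.mk _ (Sum.inl M₁)) (Quot.mk _ (Sum.inl m₁)) (π₁.map Sum.inl) :=
      hπ₁.map (κ := fun v => Quot.mk _ (Sum.inl v)) (fun _ => rfl) (fun _ => rfl)
    have p₂ : Γ.IsPath (Quot.mk _ (Sum.inr M₂)) (Quot.mk _ (Sum.inr m₂)) (π₂.map Sum.inr) :=
      hπ₂.map (κ := fun v => Quot.mk _ (Sum.inr v)) (fun _ => rfl) (fun _ => rfl)
    -- After the ends are identified the two paths are parallel, so their coefficients agree by a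
    -- defining relation.
    rw [← Quot.sound (GenLayeredGraph.Glue.max (m₁ := m₁) (M₁ := M₁) (m₂ := m₂) (M₂ := M₂)),
      ← Quot.sound (GenLayeredGraph.Glue.min (m₁ := m₁) (M₁ := M₁) (m₂ := m₂) (M₂ := M₂))] at p₂
    refine RingQuot.mkAlgHom_rel F (GenLayeredGraph.Rel.mk p₁ p₂ hj'.1 ?_)
    change j ≤ Γ₁.rank M₁ - Γ₁.rank m₁
    omega
  · have := Γ.algDegree_le_iSup_mul F hn
      (fun k => (Γ₁.algDegree F k).map j₁.toLinearMap ⊔ (Γ₂.algDegree F k).map j₂.toLinearMap) (by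
        rintro (e | e) k
        · exact Submodule.mem_sup_left ⟨_, Γ₁.a_mem_algDegree F e k, hj₁ e k⟩
        · exact Submodule.mem_sup_right ⟨_, Γ₂.a_mem_algDegree F e k, hj₂ e k⟩)
    simpa only [Submodule.mul_sup] using this
  · obtain ⟨f, hf₁, hf₂⟩ := GenLayeredGraph.exists_algHom_doubleBouquet (hr := hm₁0.trans hm₂0.symm)
      (hr' := hM₁d.trans hM₂d.symm) hm₁ hM₁ hm₂ hM₂ e₁ e₂ hm₁0 hM₁d hc₁ hc₂ f₁ f₂ hf
    exact ⟨f, GenLayeredGraph.algHom_ext (f := f.comp j₁) fun e n => by rw [AlgHom.comp_apply, hj₁, hf₁],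
      GenLayeredGraph.algHom_ext (f := f.comp j₂) fun e n => by rw [AlgHom.comp_apply, hj₂, hf₂]⟩
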